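/- **Setting.** For $\lambda>0$ let $\mathrm{Softmax}_\lambda(S)_{ik}=e^{\lambda S_{ik}}/\sum_j e^{\lambda S_{jk}}$ (softmax of each column). An $H$-head attention layer $\mathbb R^{d_{\rm in}\times N}\to\mathbb R^{d_{\rm out}\times N}$ is a map $$\mathrm{Attn}(Z)=\sum_{h=1}^H W_V^{(h)}Z\,\mathrm{Softmax}_\lambda\big((W_K^{(h)}Z)^\top W_Q^{(h)}Z\big),\qquad W_K^{(h)},W_Q^{(h)}\in\mathbb R^{d_h\times d_{\rm in}},\ W_V^{(h)}\in\mathbb R^{d_{\rm out}\times d_{\rm in}},$$ and $W_{KQ}^{(h)}=(W_K^{(h)})^\top W_Q^{(h)}$. For $d,L\ge 1$ let $P(X)=\begin{bmatrix}X&0\\ I_L&0\\ 0&1\end{bmatrix}\in\mathbb R^{(d+L+1)\times(L+1)}$ for $X\in\mathbb R^{d\times L}$ (pad a zero token and append a positional encoding), and let $T$ delete the last token (column). For $\lambda>0$, an attention-only Transformer $g\in\mathcal T(H,W,K,C_{KQ},C_V)$ with $C_{KQ},C_V>0$ is a map $g=T\circ \mathrm{Attn}^{(K)}\circ\cdots\circ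 \mathrm{Attn}^{(1)}\circ P:\mathbb R^{d\times L}\to\mathbb R^{1\times L}$, all of whose $K$ layers have $H$ heads and inverse temperature $\lambda$, where $W$ is the largest of all layer dimensions and all head dimensions $d_h$, and $C_V=\max\|W_V\|_F$, $C_{KQ}=\max\|W_{KQ}\|_F$ over all heads of all layers. For positive integers $n,r$ let $\mathcal F_{n,r}$ be the set of continuous $f:[0,1]^n\to\mathbb R$ whose weak derivatives $D^\alpha f$ on $(0,1)^n$, $|\alpha|\le r$, all exist and satisfy $\operatorname{ess\,sup}|D^\alpha f|\le 1$ (the unit ball of $W^{r,\infty}([0,1]^n)$, each element being identified with its continuous representative). **Theorem.** Let $n,r$ be positive integers. There are a constant $C>0$ and real polynomials $p,q$, depending only on $n$ and $r$, such that the following holds. Let $f^\star\in\mathcal F_{n,r}$, let $d,L$ be positive integers with $dL=n$, and let $\epsilon\in(0,1)$, $\delta=1/\epsilon$. Then there are $H,W,K,C_{KQ},C_V,\lambda$ and a Transformer $g\in\mathcal T(H,W,K,C_{KQ},C_V)$ on $\mathbb R^{d\times L}$ with inverse temperature $\lambda$ such that every entry of $g(X)\in\mathbb R^{1\times L}$ satisfies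 $$|g(X)_{1j}-f^\star(\mathrm{vec}(X))|\le\epsilon\qquad\text{for all }X\in[0,1]^{d\times L},\ 1\le j\le L,$$ where $\mathrm{vec}(X)=(x_1^\top,\dots,x_L^\top)$ lists the columns of $X$; and, if $\epsilon\le 1/2$, $$H,\,W\le C\,\delta^{n/r}\ln\delta,\quad K\le C\ln\delta,\quad C_V\le C\,\delta^{(n+2)/(2r)}\sqrt{\ln\delta},\quad C_{KQ}\le C\ln\delta,\quad \lambda\le C\,\delta^{p(\ln\delta)}(\ln\delta)^{q(\ln\delta)}.$$ -/

import Mathlib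

open scoped Matrix ContDiff

noncomputable section

/-! ### Sobolev unit ball -/

/-- The open unit cube `(0,1)^n`. -/
def openCube (n : ℕ) : Set (Fin n → ℝ) := {x | ∀ i, 0 < x i ∧ x i < 1}

/-- The partial derivative `∂ φ / ∂ x_i`. -/
def partialD {n : ℕ} (i : Fin n) (φ : (Fin n → ℝ) → ℝ) : (Fin n → ℝ) → ℝ :=
  fun x => fderiv ℝ φ x (Pi.single i 1)

/-- The mixed partial derivative `∂_1^{α_1} ⋯ ∂_n^{α_n} φ` for a multi-index `α`. -/
def multiD {n : ℕ} (α : Fin n → ℕ) (φ : (Fin n → ℝ) → ℝ) : (Fin n → ℝ) → ℝ :=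
  (List.finRange n).foldr (fun i h => (partialD i)^[α i] h) φ

/-- `g` is the weak derivative `D^α f` on the open set `U`. -/
def IsWeakDeriv {n : ℕ} (U : Set (Fin n → ℝ)) (α : Fin n → ℕ) (f g : (Fin n → ℝ) → ℝ) : Prop :=
  MeasureTheory.LocallyIntegrableOn f U MeasureTheory.volume ∧
  MeasureTheory.LocallyIntegrableOn g U MeasureTheory.volume ∧
  ∀ φ : (Fin n → ℝ) → ℝ, ContDiff ℝ ∞ φ → HasCompactSupport φ → tsupport φ ⊆ U →
    ∫ x in U, f x * multiD α φ x = (-1) ^ (∑ i, α i) * ∫ x in U, g x * φ x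

/-- `f` lies in the closed unit ball of `W^{r,∞}([0,1]^n)` for the norm
`max_{|α| ≤ r} ess sup |D^α f|`: all weak derivatives of order at most `r` (including `f` itself)
exist and are essentially bounded by `1`. -/
def MemSobolevUnitBall {n : ℕ} (r : ℕ) (f : (Fin n → ℝ) → ℝ) : Prop :=
  ∀ α : Fin n → ℕ, ∑ i, α i ≤ r → ∃ g : (Fin n → ℝ) → ℝ,
    IsWeakDeriv (openCube n) α f g ∧
    MeasureTheory.eLpNorm g ⊤ (MeasureTheory.volume.restrict (openCube n)) ≤ 1

/-! ### Attention-only Transformers -/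

section Frobenius
attribute [local instance] Matrix.frobeniusNormedAddCommGroup

/-- The Frobenius norm. -/
def frobNorm {m n : ℕ} (A : Matrix (Fin m) (Fin n) ℝ) : ℝ := ‖A‖

end Frobenius

/-- Softmax with inverse temperature `lam`, applied to each column. -/
def colSoftmax {m n : ℕ} (lam : ℝ) (S : Matrix (Fin m) (Fin n) ℝ) : Matrix (Fin m) (Fin n) ℝ :=
  Matrix.of fun i k => Real.exp (lam * S i k) / ∑ j, Real.exp (lam * S j k)

/-- The weights of an `H`-head attention layer with input dimension `din` and output
dimension `dout`. -/
structure AttnLayer (H din dout : ℕ) where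
  headDim : Fin H → ℕ
  WK : (h : Fin H) → Matrix (Fin (headDim h)) (Fin din) ℝ
  WQ : (h : Fin H) → Matrix (Fin (headDim h)) (Fin din) ℝ
  WV : Fin H → Matrix (Fin dout) (Fin din) ℝ

/-- `W_{KQ} = W_Kᵀ W_Q`. -/
def AttnLayer.WKQ {H din dout : ℕ} (A : AttnLayer H din dout) (h : Fin H) :
    Matrix (Fin din) (Fin din) ℝ :=
  (A.WK h)ᵀ * A.WQ h

/-- The map on sequences of `N` tokens computed by the layer:
`Z ↦ ∑_h W_V Z Softmax((W_K Z)ᵀ (W_Q Z))`. -/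
def AttnLayer.eval {H din dout N : ℕ} (A : AttnLayer H din dout) (lam : ℝ)
    (Z : Matrix (Fin din) (Fin N) ℝ) : Matrix (Fin dout) (Fin N) ℝ :=
  ∑ h, A.WV h * Z * colSoftmax lam ((A.WK h * Z)ᵀ * (A.WQ h * Z))

/-- A stack of `H`-head attention layers with composable dimensions. -/
inductive AttnStack (H : ℕ) : ℕ → ℕ → Type
  | nil (d : ℕ) : AttnStack H d d
  | snoc {d e f : ℕ} (S : AttnStack H d e) (A : AttnLayer H e f) : AttnStack H d f

namespace AttnStack

/-- The number of layers. -/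
def depth {H : ℕ} : {d e : ℕ} → AttnStack H d e → ℕ
  | _, _, nil _ => 0
  | _, _, snoc S _ => S.depth + 1

/-- The composition `Attn^{(K)} ∘ ⋯ ∘ Attn^{(1)}`. -/
def eval {H N : ℕ} (lam : ℝ) : {d e : ℕ} → AttnStack H d e →
    Matrix (Fin d) (Fin N) ℝ → Matrix (Fin e) (Fin N) ℝ
  | _, _, nil _, Z => Z
  | _, _, snoc S A, Z => A.eval lam (S.eval lam Z)

/-- All layer dimensions `d_j` and all head dimensions `d_h`. -/
def dims {H : ℕ} : {d e : ℕ} → AttnStack H d e → Set ℕ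
  | d, _, nil _ => {d}
  | _, e, snoc S A => S.dims ∪ {e} ∪ Set.range A.headDim

/-- The Frobenius norms of all value matrices. -/
def valueNorms {H : ℕ} : {d e : ℕ} → AttnStack H d e → Set ℝ
  | _, _, nil _ => ∅
  | _, _, snoc S A => S.valueNorms ∪ Set.range fun h => frobNorm (A.WV h)

/-- The Frobenius norms of all key-query matrices. -/
def keyQueryNorms {H : ℕ} : {d e : ℕ} → AttnStack H d e → Set ℝ
  | _, _, nil _ => ∅
  | _, _, snoc S A => S.keyQueryNorms ∪ Set.range fun h => frobNorm (A.WKQ h)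

end AttnStack

/-- The preprocessing layer: pad a zero token and append the positional encoding,
`P(X) = [X 0; I_{L+1}]`. -/
def preprocess {d L : ℕ} (X : Matrix (Fin d) (Fin L) ℝ) :
    Matrix (Fin (d + (L + 1))) (Fin (L + 1)) ℝ :=
  Matrix.of fun a t =>
    Fin.addCases (fun i => Fin.snoc (α := fun _ => ℝ) (X i) 0 t)
      (fun p => (1 : Matrix (Fin (L + 1)) (Fin (L + 1)) ℝ) p t) a

/-- The truncation layer: delete the last token. -/
def truncate {d L : ℕ} (Z : Matrix (Fin d) (Fin (L + 1)) ℝ) : Matrix (Fin d) (Fin L) ℝ :=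
  Matrix.of fun i t => Z i t.castSucc

/-- The Transformer class `T(H, W, K, C_KQ, C_V)` of maps `ℝ^{d × L} → ℝ^{dout × L}`
of the form `T ∘ Attn^{(K)} ∘ ⋯ ∘ Attn^{(1)} ∘ P`, all layers having `H` heads and
inverse temperature `lam`. -/
def TransformerClass (d L dout : ℕ) (H W K : ℕ) (CKQ CV lam : ℝ) :
    Set (Matrix (Fin d) (Fin L) ℝ → Matrix (Fin dout) (Fin L) ℝ) :=
  {g | 0 < lam ∧ 0 < CKQ ∧ 0 < CV ∧
    ∃ S : AttnStack H (d + (L + 1)) dout,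
      S.depth = K ∧ IsGreatest S.dims W ∧
      IsGreatest S.keyQueryNorms CKQ ∧ IsGreatest S.valueNorms CV ∧
      ∀ X, g X = truncate (S.eval lam (preprocess X))}

/-- `vec(X) = (x_1ᵀ, …, x_Lᵀ)`: the columns of `X`, one after the other. -/
def vecCols {d L n : ℕ} (h : L * d = n) (X : Matrix (Fin d) (Fin L) ℝ) : Fin n → ℝ :=
  fun k => X (finProdFinEquiv.symm (Fin.cast h.symm k)).2 (finProdFinEquiv.symm (Fin.cast h.symm k)).1

end

/-!
# Approximation of Sobolev functions by attention-only Transformers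

A Transformer can compute, without any error, sums of products of differences of sigmoid units, and
such sums approximate the elements of the Sobolev ball at the stated rate.

*Exactness.* Keep the token matrix in the form `y pᵀ`, where `p` is `0` at the last token and `1` at
all others, and let one coordinate of `y` be `1`. A head whose keys read that coordinate
and whose queries are `q ⬝ y` splits its attention between the `L` equal tokens and the last, zero
token, so that it outputs `A y` times `sigmoid (lam * (q ⬝ y) + log L)`. Two heads with value
matrices `A` and `-A` cancel at the last token, whose query is `0`; such pairs preserve the form
`y pᵀ` and multiply `A y` by a difference of two sigmoids (`pairLayer_eval_vecMulVec`). In the first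
layer, the positional encoding allows such pairs to copy the entries of the input to all tokens
(`gatherLayer_eval`). Consequently each layer multiplies every coordinate of `y` by a `Gate`
depending on the input, and sums of products of gates are computed exactly, with one coordinate
per product and one layer per factor (`exists_transformer_sum_prod`).

*Approximation.* Mollification inside the cube reduces the claim to smooth functions whose
derivatives of order at most `r` are bounded by `1` (`exists_smooth_approx`), for which Taylor's
theorem holds along segments (`abs_sub_taylor_le`). Differences of steep sigmoids with thresholds
in `ℤ / N` are a partition of unity up to an exponentially small error, and glue the Taylor
polynomials at the `(N + 2) ^ n` cells to an approximation of order `N ^ (-r)`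
(`abs_sum_prod_bump_mul_sub_le`). The factors `x i - t i` of the polynomials are replaced by
`(4 / τ) * (sigmoid (τ * (x i - t i)) - 1 / 2)`, where `4 / τ = 2 ^ M`. The factors `2 ^ M` may be
too large for a single value matrix, so they are distributed over `M` additional layers. Taking `N`
of order `δ ^ (1 / r)` and `M` of order `log δ` gives the theorem; the inverse temperature
`N * (N + 2) ^ n * N ^ r` is a power of `δ`.
-/

noncomputable section

/-! ### Attention layers acting on rank-one token matrices -/

/-- The last token carries `0`, every other token carries `1`. -/
def tokenMask (L : ℕ) : Fin (L + 1) → ℝ := Fin.snoc (α := fun _ => ℝ) (fun _ => 1) 0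

@[simp] lemma tokenMask_castSucc {L : ℕ} (t : Fin L) : tokenMask L t.castSucc = 1 := by
  simp [tokenMask]

@[simp] lemma tokenMask_last (L : ℕ) : tokenMask L (Fin.last L) = 0 := by
  simp [tokenMask]

/-- The attention weights of a head with one-dimensional keys and queries, given by the linear
forms `k` and `q`. -/
def attnWeights {D N : ℕ} (lam : ℝ) (k q : Fin D → ℝ) (Z : Matrix (Fin D) (Fin N) ℝ) :
    Matrix (Fin N) (Fin N) ℝ :=
  colSoftmax lam (Matrix.vecMulVec (k ᵥ* Z) (q ᵥ* Z))

/-- An attention layer whose heads come in pairs: the two heads of pair `j` share the key form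
`k j`, have query forms `q j` and `q' j`, and value matrices `A j` and `-A j`. -/
def pairLayer {J din dout : ℕ} (k q q' : Fin J → Fin din → ℝ)
    (A : Fin J → Matrix (Fin dout) (Fin din) ℝ) : AttnLayer (J * 2) din dout where
  headDim _ := 1
  WK h := Matrix.of fun _ => k (finProdFinEquiv.symm h).1
  WQ h := Matrix.of fun _ =>
    if (finProdFinEquiv.symm h).2 = 0 then q (finProdFinEquiv.symm h).1
      else q' (finProdFinEquiv.symm h).1
  WV h := if (finProdFinEquiv.symm h).2 = 0 then A (finProdFinEquiv.symm h).1
      else -A (finProdFinEquiv.symm h).1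

lemma transpose_mul_of_const {D N : ℕ} (k q : Fin D → ℝ) (Z : Matrix (Fin D) (Fin N) ℝ) :
    ((Matrix.of fun (_ : Fin 1) => k) * Z)ᵀ * ((Matrix.of fun (_ : Fin 1) => q) * Z) =
      Matrix.vecMulVec (k ᵥ* Z) (q ᵥ* Z) := by
  ext i t
  simp [Matrix.mul_apply, Matrix.vecMulVec_apply, Matrix.vecMul, dotProduct, mul_comm (Z _ _)]

lemma pairLayer_eval {J din dout N : ℕ} (k q q' : Fin J → Fin din → ℝ)
    (A : Fin J → Matrix (Fin dout) (Fin din) ℝ) (lam : ℝ) (Z : Matrix (Fin din) (Fin N) ℝ) :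
    (pairLayer k q q' A).eval lam Z =
      ∑ j, A j * Z * (attnWeights lam (k j) (q j) Z - attnWeights lam (k j) (q' j) Z) := by
  unfold AttnLayer.eval
  rw [← Equiv.sum_comp finProdFinEquiv, Fintype.sum_prod_type]
  refine Finset.sum_congr rfl fun j _ => ?_
  simp only [Fin.sum_univ_two]
  simp only [pairLayer, Equiv.symm_apply_apply]
  simp only [Fin.isValue, ↓reduceIte, one_ne_zero, Matrix.neg_mul, Matrix.mul_sub, attnWeights]
  rw [sub_eq_add_neg]
  congr 1
  · congr 2; exact transpose_mul_of_const _ _ _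
  · congr 3; exact transpose_mul_of_const _ _ _

lemma colSoftmax_apply {m n : ℕ} (lam : ℝ) (S : Matrix (Fin m) (Fin n) ℝ) (i k) :
    colSoftmax lam S i k = Real.exp (lam * S i k) / ∑ j, Real.exp (lam * S j k) := rfl

lemma colSoftmax_congr {m n : ℕ} (lam : ℝ) {S S' : Matrix (Fin m) (Fin n) ℝ} {k : Fin n}
    (h : ∀ i, S i k = S' i k) (i : Fin m) : colSoftmax lam S i k = colSoftmax lam S' i k := by
  simp [colSoftmax_apply, h]

/-- On token matrices `y pᵀ`, with `p` the token mask, a head whose key form takes the value `1`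
at `y` puts the total weight `sigmoid (lam * (q ⬝ y) + log L)` on the first `L` tokens. -/
lemma mask_vecMul_attnWeights {D L : ℕ} (hL : 0 < L) (lam : ℝ) (k q y : Fin D → ℝ)
    (hk : k ⬝ᵥ y = 1) (t : Fin L) :
    (tokenMask L ᵥ* attnWeights lam k q (Matrix.vecMulVec y (tokenMask L))) t.castSucc =
      Real.sigmoid (lam * (q ⬝ᵥ y) + Real.log L) := by
  have hL' : (0 : ℝ) < L := by exact_mod_cast hL
  have hs : ∀ r : Fin D → ℝ, ∀ i, (r ᵥ* Matrix.vecMulVec y (tokenMask L)) i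
      = (r ⬝ᵥ y) * tokenMask L i := by
    intro r i
    simp [Matrix.vecMul_vecMulVec]
  simp only [Matrix.vecMul, dotProduct, Fin.sum_univ_castSucc, tokenMask_castSucc, tokenMask_last]
  simp only [attnWeights, colSoftmax_apply, Matrix.vecMulVec_apply, hs, hk,
    Fin.sum_univ_castSucc, tokenMask_castSucc, tokenMask_last]
  simp only [one_mul, mul_one, zero_mul, mul_zero, add_zero, Real.exp_zero, Finset.sum_const,
    Finset.card_univ, Fintype.card_fin, nsmul_eq_mul, Real.sigmoid_def]
  rw [neg_add, Real.exp_add, Real.exp_neg, Real.exp_neg, Real.exp_log hL']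
  simp only [dotProduct]
  have := Real.exp_pos (lam * ∑ i, q i * y i)
  field_simp

/-- The two heads of a pair agree on the query of the last token, so this layer keeps the rank-one
form, and gates the coordinates of `y`. -/
lemma pairLayer_eval_vecMulVec {J din dout L : ℕ} (hL : 0 < L) (k q q' : Fin J → Fin din → ℝ)
    (A : Fin J → Matrix (Fin dout) (Fin din) ℝ) (lam : ℝ) (y : Fin din → ℝ)
    (hk : ∀ j, k j ⬝ᵥ y = 1) :
    (pairLayer k q q' A).eval lam (Matrix.vecMulVec y (tokenMask L)) =
      Matrix.vecMulVec (∑ j, (Real.sigmoid (lam * (q j ⬝ᵥ y) + Real.log L) -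
        Real.sigmoid (lam * (q' j ⬝ᵥ y) + Real.log L)) • (A j *ᵥ y)) (tokenMask L) := by
  rw [pairLayer_eval]
  ext b t
  simp only [Matrix.mul_vecMulVec, Matrix.vecMulVec_mul, Matrix.sum_apply, Matrix.vecMulVec_apply,
    Matrix.vecMul_sub, Finset.sum_apply, Pi.smul_apply, smul_eq_mul, Pi.sub_apply, Finset.sum_mul]
  refine Finset.sum_congr rfl fun j _ => ?_
  induction t using Fin.lastCases with
  | last =>
    -- The query of the last token vanishes, so both heads attend uniformly and cancel.
    have : ∀ i, attnWeights lam (k j) (q j) (Matrix.vecMulVec y (tokenMask L)) i (Fin.last L) =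
        attnWeights lam (k j) (q' j) (Matrix.vecMulVec y (tokenMask L)) i (Fin.last L) := by
      intro i
      refine colSoftmax_congr _ (fun i => ?_) i
      simp [Matrix.vecMulVec_apply, Matrix.vecMul_vecMulVec]
    simp [Matrix.vecMul, dotProduct, this]
  | cast t =>
    rw [mask_vecMul_attnWeights hL _ _ _ _ (hk j), mask_vecMul_attnWeights hL _ _ _ _ (hk j)]
    simp
    ring

/-! ### Gathering the input -/

/-- The weight that a pair of copying heads transports from a token to all tokens. -/
def copyWeight (L : ℕ) (lam : ℝ) : ℝ :=
  (Real.exp lam - Real.exp (-lam)) / (Real.exp lam + Real.exp (-lam) + (L - 1))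

/-- The key form that is `1` at the token `i`, `-1` at the last token, and `0` elsewhere. -/
def copyKey (d : ℕ) {L : ℕ} (i : Fin L) : Fin (d + (L + 1)) → ℝ :=
  Fin.addCases (fun _ => 0) (Pi.single i.castSucc 1 - Pi.single (Fin.last L) 1)

/-- The query form that equals the token mask. -/
def copyQuery (d L : ℕ) : Fin (d + (L + 1)) → ℝ :=
  Fin.addCases (fun _ => 0) (tokenMask L)

lemma vecMul_preprocess {d L : ℕ} (X : Matrix (Fin d) (Fin L) ℝ) (w : Fin (L + 1) → ℝ) :
    (Fin.addCases (motive := fun _ => ℝ) (fun _ => 0) w : Fin (d + (L + 1)) → ℝ) ᵥ* preprocess X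
      = w := by
  ext t
  simp [Matrix.vecMul, dotProduct, Fin.sum_univ_add, preprocess, Matrix.one_apply]

lemma copyKey_vecMul {d L : ℕ} (i : Fin L) (X : Matrix (Fin d) (Fin L) ℝ) :
    copyKey d i ᵥ* preprocess X = Pi.single i.castSucc 1 - Pi.single (Fin.last L) 1 :=
  vecMul_preprocess X _

lemma copyQuery_vecMul {d L : ℕ} (X : Matrix (Fin d) (Fin L) ℝ) :
    copyQuery d L ᵥ* preprocess X = tokenMask L :=
  vecMul_preprocess X _

lemma attnWeights_copy {d L : ℕ} (lam : ℝ) (i : Fin L) (X : Matrix (Fin d) (Fin L) ℝ)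
    (a : Fin (L + 1)) (t : Fin L) :
    attnWeights lam (copyKey d i) (copyQuery d L) (preprocess X) a t.castSucc -
      attnWeights lam (copyKey d i) (-copyQuery d L) (preprocess X) a t.castSucc =
    copyWeight L lam * ((Pi.single i.castSucc 1 - Pi.single (Fin.last L) 1 : Fin (L + 1) → ℝ) a) := by
  have hne : ∀ j : Fin L, j.castSucc ≠ Fin.last L := fun j => Fin.castSucc_ne_last j
  -- Negating the scores does not change the denominator of the softmax.
  have hsum : ∀ s : ℝ, ∑ j : Fin (L + 1), Real.exp (s *
      ((Pi.single i.castSucc 1 - Pi.single (Fin.last L) 1 : Fin (L + 1) → ℝ) j)) =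
      Real.exp s + Real.exp (-s) + (L - 1) := by
    intro s
    rw [Fin.sum_univ_castSucc, ← Finset.add_sum_erase _ _ (Finset.mem_univ i),
      Finset.sum_congr rfl (g := fun _ => (1 : ℝ))]
    · have : 1 ≤ L := Nat.succ_le_of_lt (Nat.lt_of_le_of_lt (Nat.zero_le _) i.2)
      simp [(hne i).symm, hne, Nat.cast_sub this]
      ring
    · intro j hj
      have : j ≠ i := Finset.ne_of_mem_erase hj
      simp [hne, this]
  unfold attnWeights
  rw [Matrix.neg_vecMul, copyKey_vecMul, copyQuery_vecMul,
    colSoftmax_apply, colSoftmax_apply]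
  simp only [Matrix.vecMulVec_apply, Pi.neg_apply, tokenMask_castSucc, mul_one, mul_neg]
  simp only [← neg_mul, hsum, neg_neg]
  rw [add_comm (Real.exp (-lam)), ← sub_div, copyWeight, div_mul_eq_mul_div]
  congr 1
  rcases eq_or_ne a i.castSucc with h | h
  · subst h; simp [hne]
  · rcases eq_or_ne a (Fin.last L) with h' | h'
    · subst h'; simp [(hne i).symm]
    · simp [h, h']

/-- A pair of copying heads transports, up to a constant factor, the value of a row at token `i`
minus its value at the last token to all tokens but the last. -/
lemma preprocess_mul_attnWeights_copy {d L : ℕ} (lam : ℝ) (i : Fin L)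
    (X : Matrix (Fin d) (Fin L) ℝ) (a : Fin (d + (L + 1))) (t : Fin (L + 1)) :
    (preprocess X * (attnWeights lam (copyKey d i) (copyQuery d L) (preprocess X) -
      attnWeights lam (copyKey d i) (-copyQuery d L) (preprocess X))) a t =
    copyWeight L lam * (preprocess X a i.castSucc - preprocess X a (Fin.last L)) *
      tokenMask L t := by
  induction t using Fin.lastCases with
  | last =>
    have : ∀ b, attnWeights lam (copyKey d i) (copyQuery d L) (preprocess X) b (Fin.last L) =
        attnWeights lam (copyKey d i) (-copyQuery d L) (preprocess X) b (Fin.last L) := by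
      intro b
      refine colSoftmax_congr _ (fun i => ?_) b
      simp [Matrix.neg_vecMul, Matrix.vecMulVec_apply, copyQuery_vecMul]
    simp [Matrix.mul_apply, this]
  | cast t =>
    simp only [Matrix.mul_apply, Matrix.sub_apply, attnWeights_copy, tokenMask_castSucc, mul_one]
    simp only [Pi.sub_apply, mul_sub, Finset.sum_sub_distrib, Pi.single_apply]
    simp
    ring

lemma copyWeight_pos {L : ℕ} (hL : 0 < L) {lam : ℝ} (hlam : 1 ≤ lam) : 0 < copyWeight L lam := by
  have hL' : (1 : ℝ) ≤ L := by exact_mod_cast hL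
  have h1 : Real.exp (-lam) < Real.exp lam := Real.exp_lt_exp.2 (by linarith)
  have h2 := Real.exp_pos (-lam)
  exact div_pos (by linarith) (by linarith)

/-- This bounds the value matrices of the first layer. -/
lemma inv_copyWeight_le {L : ℕ} (hL : 0 < L) {lam : ℝ} (hlam : 1 ≤ lam) :
    (copyWeight L lam)⁻¹ ≤ L + 2 := by
  have hL' : (1 : ℝ) ≤ L := by exact_mod_cast hL
  have h1 : Real.exp (-lam) ≤ 1 / 2 := by
    have := Real.exp_neg_one_lt_half
    exact (Real.exp_le_exp.2 (by linarith)).trans this.le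
  have h2 : 2 ≤ Real.exp lam := by have := Real.add_one_le_exp lam; linarith
  unfold copyWeight
  rw [inv_div, div_le_iff₀ (by linarith)]
  nlinarith

/-! ### Frobenius norms -/

lemma frobNorm_sq {m n : ℕ} (A : Matrix (Fin m) (Fin n) ℝ) :
    frobNorm A = √(∑ i, ∑ j, A i j ^ 2) := by
  unfold frobNorm
  rw [Matrix.frobenius_norm_def, Real.sqrt_eq_rpow]
  simp

lemma frobNorm_pos {m n : ℕ} {A : Matrix (Fin m) (Fin n) ℝ} {i j} (h : A i j ≠ 0) :
    0 < frobNorm A := by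
  rw [frobNorm_sq]
  refine Real.sqrt_pos.2 ?_
  refine Finset.sum_pos' (fun _ _ => Finset.sum_nonneg fun _ _ => sq_nonneg _)
    ⟨i, Finset.mem_univ _, Finset.sum_pos' (fun _ _ => sq_nonneg _) ⟨j, Finset.mem_univ _, ?_⟩⟩
  positivity

lemma frobNorm_neg {m n : ℕ} (A : Matrix (Fin m) (Fin n) ℝ) : frobNorm (-A) = frobNorm A := by
  simp [frobNorm_sq]

lemma frobNorm_single {m n : ℕ} (i : Fin m) (j : Fin n) (v : ℝ) :
    frobNorm (Matrix.single i j v) = |v| := by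
  rw [frobNorm_sq, ← Real.sqrt_sq_eq_abs]
  congr 1
  rw [Finset.sum_eq_single i, Finset.sum_eq_single j]
  · simp
  · intro b _ hb; simp [hb.symm]
  · simp
  · intro a _ ha; simp [ha.symm]
  · simp

lemma frobNorm_vecMulVec_le {m n : ℕ} (k : Fin m → ℝ) (q : Fin n → ℝ) :
    frobNorm (Matrix.vecMulVec k q) ≤ (∑ i, |k i|) * ∑ j, |q j| := by
  rw [frobNorm_sq]
  have h : ∀ {m : ℕ} (k : Fin m → ℝ), ∑ i, k i ^ 2 ≤ (∑ i, |k i|) ^ 2 := by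
    intro m k
    have := Finset.sum_sq_le_sq_sum_of_nonneg (s := Finset.univ) (f := fun i => |k i|)
      (fun _ _ => abs_nonneg _)
    simpa using this
  have hk : (0 : ℝ) ≤ ∑ i, |k i| := Finset.sum_nonneg fun _ _ => abs_nonneg _
  have hq : (0 : ℝ) ≤ ∑ i, |q i| := Finset.sum_nonneg fun _ _ => abs_nonneg _
  rw [← Real.sqrt_sq (mul_nonneg hk hq)]
  refine Real.sqrt_le_sqrt ?_
  simp only [Matrix.vecMulVec_apply, mul_pow, ← Finset.mul_sum, ← Finset.sum_mul]
  exact mul_le_mul (h k) (h q) (Finset.sum_nonneg fun _ _ => sq_nonneg _) (sq_nonneg _)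

lemma transpose_mul_of_const_apply {m n : ℕ} (k : Fin m → ℝ) (q : Fin n → ℝ) (a b) :
    ((Matrix.of fun (_ : Fin 1) => k)ᵀ * (Matrix.of fun (_ : Fin 1) => q)) a b =
      Matrix.vecMulVec k q a b := by
  simp [Matrix.mul_apply, Matrix.vecMulVec_apply]

lemma pairLayer_WKQ {J din dout : ℕ} (k q q' : Fin J → Fin din → ℝ)
    (A : Fin J → Matrix (Fin dout) (Fin din) ℝ) (h : Fin (J * 2)) :
    ∃ j, (pairLayer k q q' A).WKQ h = Matrix.vecMulVec (k j) (q j) ∨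
      (pairLayer k q q' A).WKQ h = Matrix.vecMulVec (k j) (q' j) := by
  refine ⟨(finProdFinEquiv.symm h).1, ?_⟩
  by_cases h0 : (finProdFinEquiv.symm h).2 = 0
  · left; ext a b
    simp only [AttnLayer.WKQ, pairLayer, h0, if_true]
    exact transpose_mul_of_const_apply _ _ a b
  · right; ext a b
    simp only [AttnLayer.WKQ, pairLayer, h0, if_false]
    exact transpose_mul_of_const_apply _ _ a b

/-! ### Stacks of layers -/

namespace AttnStack

lemma dims_nil {H d : ℕ} : (nil d : AttnStack H d d).dims = {d} := by rw [dims]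

lemma valueNorms_nil {H d : ℕ} : (nil d : AttnStack H d d).valueNorms = ∅ := by rw [valueNorms]

lemma keyQueryNorms_nil {H d : ℕ} : (nil d : AttnStack H d d).keyQueryNorms = ∅ := by rw [keyQueryNorms]

lemma dims_snoc {H d e f : ℕ} (S : AttnStack H d e) (A : AttnLayer H e f) :
    (snoc S A).dims = S.dims ∪ {f} ∪ Set.range A.headDim := by rw [dims]

lemma valueNorms_snoc {H d e f : ℕ} (S : AttnStack H d e) (A : AttnLayer H e f) :
    (snoc S A).valueNorms = S.valueNorms ∪ Set.range fun h => frobNorm (A.WV h) := by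
  rw [valueNorms]

lemma keyQueryNorms_snoc {H d e f : ℕ} (S : AttnStack H d e) (A : AttnLayer H e f) :
    (snoc S A).keyQueryNorms = S.keyQueryNorms ∪ Set.range fun h => frobNorm (A.WKQ h) := by
  rw [keyQueryNorms]

lemma depth_snoc {H d e f : ℕ} (S : AttnStack H d e) (A : AttnLayer H e f) :
    (snoc S A).depth = S.depth + 1 := by rw [depth]

lemma eval_snoc {H N d e f : ℕ} (lam : ℝ) (S : AttnStack H d e) (A : AttnLayer H e f)
    (Z : Matrix (Fin d) (Fin N) ℝ) : (snoc S A).eval lam Z = A.eval lam (S.eval lam Z) := by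
  rw [eval]

lemma finite_dims {H d e : ℕ} (S : AttnStack H d e) : S.dims.Finite := by
  induction S with
  | nil => rw [dims_nil]; exact Set.finite_singleton _
  | snoc S A ih =>
    rw [dims_snoc]
    exact (ih.union (Set.finite_singleton _)).union (Set.finite_range _)

lemma finite_valueNorms {H d e : ℕ} (S : AttnStack H d e) : S.valueNorms.Finite := by
  induction S with
  | nil => rw [valueNorms_nil]; exact Set.finite_empty
  | snoc S A ih => rw [valueNorms_snoc]; exact ih.union (Set.finite_range _)

lemma finite_keyQueryNorms {H d e : ℕ} (S : AttnStack H d e) : S.keyQueryNorms.Finite := by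
  induction S with
  | nil => rw [keyQueryNorms_nil]; exact Set.finite_empty
  | snoc S A ih => rw [keyQueryNorms_snoc]; exact ih.union (Set.finite_range _)

/-- The stack that applies the layer `first` and then the layers `gate 0, …, gate (K - 1)`. -/
def iterate {H din D : ℕ} (first : AttnLayer H din D) (gate : ℕ → AttnLayer H D D) :
    ℕ → AttnStack H din D
  | 0 => snoc (nil din) first
  | K + 1 => snoc (iterate first gate K) (gate K)

section iterate
variable {H din D : ℕ} (first : AttnLayer H din D) (gate : ℕ → AttnLayer H D D)

lemma iterate_depth (K : ℕ) : (iterate first gate K).depth = K + 1 := by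
  induction K with
  | zero => rw [iterate, depth_snoc, depth]
  | succ K ih => rw [iterate, depth_snoc, ih]

lemma mem_dims_iterate {K m : ℕ} (h : m ∈ (iterate first gate K).dims) :
    m = din ∨ m = D ∨ (∃ i, m = first.headDim i) ∨ ∃ s i, m = (gate s).headDim i := by
  induction K with
  | zero =>
    rw [iterate, dims_snoc, dims_nil] at h
    rcases h with (h | h) | ⟨i, rfl⟩
    · exact Or.inl h
    · exact Or.inr (Or.inl h)
    · exact Or.inr (Or.inr (Or.inl ⟨i, rfl⟩))
  | succ K ih =>
    rw [iterate, dims_snoc] at h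
    rcases h with (h | h) | ⟨i, rfl⟩
    · exact ih h
    · exact Or.inr (Or.inl h)
    · exact Or.inr (Or.inr (Or.inr ⟨K, i, rfl⟩))

lemma mem_valueNorms_iterate {K : ℕ} {m : ℝ} (h : m ∈ (iterate first gate K).valueNorms) :
    (∃ i, m = frobNorm (first.WV i)) ∨ ∃ s i, m = frobNorm ((gate s).WV i) := by
  induction K with
  | zero =>
    rw [iterate, valueNorms_snoc, valueNorms_nil] at h
    rcases h with h | ⟨i, rfl⟩
    · exact h.elim
    · exact Or.inl ⟨i, rfl⟩
  | succ K ih =>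
    rw [iterate, valueNorms_snoc] at h
    rcases h with h | ⟨i, rfl⟩
    · exact ih h
    · exact Or.inr ⟨K, i, rfl⟩

lemma mem_keyQueryNorms_iterate {K : ℕ} {m : ℝ} (h : m ∈ (iterate first gate K).keyQueryNorms) :
    (∃ i, m = frobNorm (first.WKQ i)) ∨ ∃ s i, m = frobNorm ((gate s).WKQ i) := by
  induction K with
  | zero =>
    rw [iterate, keyQueryNorms_snoc, keyQueryNorms_nil] at h
    rcases h with h | ⟨i, rfl⟩
    · exact h.elim
    · exact Or.inl ⟨i, rfl⟩
  | succ K ih =>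
    rw [iterate, keyQueryNorms_snoc] at h
    rcases h with h | ⟨i, rfl⟩
    · exact ih h
    · exact Or.inr ⟨K, i, rfl⟩

lemma valueNorms_first_mem (K : ℕ) (i : Fin H) :
    frobNorm (first.WV i) ∈ (iterate first gate K).valueNorms := by
  induction K with
  | zero => rw [iterate, valueNorms_snoc]; exact Or.inr ⟨i, rfl⟩
  | succ K ih => rw [iterate, valueNorms_snoc]; exact Or.inl ih

lemma keyQueryNorms_first_mem (K : ℕ) (i : Fin H) :
    frobNorm (first.WKQ i) ∈ (iterate first gate K).keyQueryNorms := by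
  induction K with
  | zero => rw [iterate, keyQueryNorms_snoc]; exact Or.inr ⟨i, rfl⟩
  | succ K ih => rw [iterate, keyQueryNorms_snoc]; exact Or.inl ih

end iterate

end AttnStack

lemma pairLayer_WV_single {J din dout : ℕ} (k q q' : Fin J → Fin din → ℝ)
    (row : Fin J → Fin dout) (col : Fin J → Fin din) (v : Fin J → ℝ) (h : Fin (J * 2)) :
    ∃ j, frobNorm ((pairLayer k q q' fun j => Matrix.single (row j) (col j) (v j)).WV h) =
      |v j| := by
  refine ⟨(finProdFinEquiv.symm h).1, ?_⟩
  by_cases h0 : (finProdFinEquiv.symm h).2 = 0 <;>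
    simp only [pairLayer, h0, if_true, if_false, frobNorm_neg, frobNorm_single]

/-! ### Products of sigmoid differences -/

/-- The data of a scaled difference of two sigmoid units on `ℝ^n`, with affine arguments
`a + w ⬝ x` and `a' + w' ⬝ x`. -/
structure Gate (n : ℕ) where
  scale : ℝ
  a : ℝ
  w : Fin n → ℝ
  a' : ℝ
  w' : Fin n → ℝ

namespace Gate

/-- The function computed by a gate at inverse temperature `lam`. -/
def eval {n : ℕ} (lam : ℝ) (g : Gate n) (x : Fin n → ℝ) : ℝ :=
  g.scale * (Real.sigmoid (lam * (g.a + g.w ⬝ᵥ x)) - Real.sigmoid (lam * (g.a' + g.w' ⬝ᵥ x)))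

/-- All parameters of the gate are at most `B`. -/
def Bounded {n : ℕ} (B : ℝ) (g : Gate n) : Prop :=
  |g.scale| ≤ B ∧ |g.a| + ∑ i, |g.w i| ≤ B ∧ |g.a'| + ∑ i, |g.w' i| ≤ B

/-- The constant gate with value `c`. -/
def const (n : ℕ) (lam c : ℝ) : Gate n where
  scale := c * (Real.sigmoid lam - 1 / 2)⁻¹
  a := 1
  w := 0
  a' := 0
  w' := 0

lemma sigmoid_sub_half_gt {lam : ℝ} (h : 1 ≤ lam) : 1 / 8 ≤ Real.sigmoid lam - 1 / 2 := by
  have h1 : Real.exp (-1) < 1 / 2 := Real.exp_neg_one_lt_half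
  have h2 : Real.sigmoid 1 ≤ Real.sigmoid lam := Real.sigmoid_le h
  have h3 : 5 / 8 ≤ Real.sigmoid 1 := by
    rw [Real.sigmoid_def, le_inv_comm₀ (by norm_num) (by positivity)]
    norm_num at h1 ⊢
    linarith
  linarith

lemma const_eval (n : ℕ) {lam : ℝ} (h : 1 ≤ lam) (c : ℝ) (x : Fin n → ℝ) :
    (const n lam c).eval lam x = c := by
  have := sigmoid_sub_half_gt h
  have h0 : Real.sigmoid lam - 1 / 2 ≠ 0 := by linarith
  simp only [eval, const, zero_dotProduct, add_zero, mul_one, mul_zero, Real.sigmoid_zero]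
  rw [← one_div 2, mul_assoc, inv_mul_cancel₀ h0, mul_one]

lemma const_bounded (n : ℕ) {lam c B : ℝ} (h : 1 ≤ lam) (hB : 1 ≤ B) (hc : 8 * |c| ≤ B) :
    (const n lam c).Bounded B := by
  have h8 := sigmoid_sub_half_gt h
  refine ⟨?_, by simpa [const] using hB, by simpa [const] using by linarith⟩
  have h0 : (0 : ℝ) < Real.sigmoid lam - 1 / 2 := by linarith
  simp only [const]
  rw [abs_mul, abs_inv, abs_of_pos h0, ← div_eq_mul_inv, div_le_iff₀ h0]
  nlinarith [abs_nonneg c]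

end Gate

/-! ### Transformers computing sums of products -/

section Network

variable {n D L : ℕ} {T : Type*}

/-- The common content of the tokens: the constant `1`, the input `x`, and one coordinate for each
product. -/
def stateVec (e : Fin D ≃ Option (Fin n ⊕ T)) (x : Fin n → ℝ) (z : T → ℝ) : Fin D → ℝ :=
  fun b => (e b).elim 1 (Sum.elim x z)

/-- The query form realizing the affine form `a + w ⬝ x`; the offset `-log L / lam` compensates for
the `L` tokens that share the attention. -/
def affineQuery (e : Fin D ≃ Option (Fin n ⊕ T)) (L : ℕ) (lam a : ℝ) (w : Fin n → ℝ) :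
    Fin D → ℝ :=
  fun b => (e b).elim (a - Real.log L / lam) (Sum.elim w 0)

lemma affineQuery_dotProduct [Fintype T] (e : Fin D ≃ Option (Fin n ⊕ T)) {lam : ℝ} (hlam : 0 < lam)
    (a : ℝ) (w x : Fin n → ℝ) (z : T → ℝ) :
    lam * (affineQuery e L lam a w ⬝ᵥ stateVec e x z) + Real.log L = lam * (a + w ⬝ᵥ x) := by
  have : affineQuery e L lam a w ⬝ᵥ stateVec e x z = a - Real.log L / lam + w ⬝ᵥ x := by
    unfold dotProduct affineQuery stateVec
    rw [Equiv.sum_comp e (fun b : Option (Fin n ⊕ T) => b.elim (a - Real.log L / lam) (Sum.elim w 0)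
      * b.elim 1 (Sum.elim x z))]
    simp [Fintype.sum_option, Fintype.sum_sum_type]
  rw [this]
  field_simp
  ring

lemma sum_abs_affineQuery_le [Fintype T] (e : Fin D ≃ Option (Fin n ⊕ T)) (hL : 0 < L) {lam : ℝ}
    (hlam : 1 ≤ lam) (a : ℝ) (w : Fin n → ℝ) :
    ∑ b, |affineQuery e L lam a w b| ≤ |a| + ∑ i, |w i| + L := by
  have hL' : (1 : ℝ) ≤ L := by exact_mod_cast hL
  unfold affineQuery
  rw [Equiv.sum_comp e (fun b : Option (Fin n ⊕ T) =>
    |b.elim (a - Real.log L / lam) (Sum.elim w 0)|)]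
  simp only [Fintype.sum_option, Fintype.sum_sum_type, Option.elim, Sum.elim_inl, Sum.elim_inr,
    Pi.zero_apply, abs_zero, Finset.sum_const_zero, add_zero]
  have h1 : 0 ≤ Real.log L := Real.log_nonneg hL'
  have h2 : Real.log L / lam ≤ L :=
    (div_le_self h1 hlam).trans ((Real.log_le_sub_one_of_pos (by linarith)).trans (by linarith))
  have h3 : |a - Real.log L / lam| ≤ |a| + L := by
    refine (abs_sub _ _).trans ?_
    rw [abs_of_nonneg (div_nonneg h1 (by linarith))]
    linarith
  linarith

/-- The layer multiplying the coordinate `b` of the token content by the gate `g b`, and placing the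
result in row `row b`. -/
def gateLayer {dout : ℕ} (e : Fin D ≃ Option (Fin n ⊕ T)) (L : ℕ) (lam : ℝ) (row : Fin D → Fin dout)
    (g : Option (Fin n ⊕ T) → Gate n) : AttnLayer (D * 2) D dout :=
  pairLayer (fun _ => Pi.single (e.symm none) 1)
    (fun b => affineQuery e L lam (g (e b)).a (g (e b)).w)
    (fun b => affineQuery e L lam (g (e b)).a' (g (e b)).w')
    (fun b => Matrix.single (row b) b (g (e b)).scale)

lemma gateLayer_eval [Fintype T] {dout : ℕ} (e : Fin D ≃ Option (Fin n ⊕ T)) (hL : 0 < L) {lam : ℝ}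
    (hlam : 0 < lam) (row : Fin D → Fin dout) (g : Option (Fin n ⊕ T) → Gate n)
    (x : Fin n → ℝ) (z : T → ℝ) :
    (gateLayer e L lam row g).eval lam (Matrix.vecMulVec (stateVec e x z) (tokenMask L)) =
      Matrix.vecMulVec (fun i => ∑ b, if row b = i then (g (e b)).eval lam x * stateVec e x z b
        else 0) (tokenMask L) := by
  unfold gateLayer
  rw [pairLayer_eval_vecMulVec hL]
  · congr 1
    ext i
    rw [Finset.sum_apply]
    refine Finset.sum_congr rfl fun b _ => ?_
    rw [affineQuery_dotProduct e hlam, affineQuery_dotProduct e hlam]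
    simp only [Pi.smul_apply, smul_eq_mul, Gate.eval]
    by_cases h : row b = i
    · subst h; simp [Matrix.single_mulVec]; ring
    · simp [Matrix.single_mulVec, Function.update_of_ne (Ne.symm h), h]
  · intro j
    simp [stateVec]

/-- The layer copying, for each `b`, the entry in row `src b` of the preprocessed token `tok b` to
row `b` of all tokens but the last. -/
def gatherLayer {d : ℕ} (lam : ℝ) (src : Fin D → Fin (d + (L + 1))) (tok : Fin D → Fin L) :
    AttnLayer (D * 2) (d + (L + 1)) D :=
  pairLayer (fun b => copyKey d (tok b)) (fun _ => copyQuery d L) (fun _ => -copyQuery d L)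
    (fun b => Matrix.single b (src b) (copyWeight L lam)⁻¹)

lemma gatherLayer_eval {d : ℕ} (hL : 0 < L) {lam : ℝ} (hlam : 1 ≤ lam)
    (src : Fin D → Fin (d + (L + 1))) (tok : Fin D → Fin L) (X : Matrix (Fin d) (Fin L) ℝ) :
    (gatherLayer lam src tok).eval lam (preprocess X) =
      Matrix.vecMulVec (fun b => preprocess X (src b) (tok b).castSucc -
        preprocess X (src b) (Fin.last L)) (tokenMask L) := by
  unfold gatherLayer
  rw [pairLayer_eval]
  ext i t
  have h0 := (copyWeight_pos hL hlam).ne'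
  rw [Matrix.sum_apply, Finset.sum_eq_single i]
  · rw [Matrix.mul_assoc, Matrix.single_mul_apply_same, preprocess_mul_attnWeights_copy,
      Matrix.vecMulVec_apply]
    field_simp
  · intro b _ hb
    rw [Matrix.mul_assoc, Matrix.single_mul_apply_of_ne _ _ _ _ _ hb.symm]
  · simp

lemma sum_abs_copyKey_le {d : ℕ} (i : Fin L) : ∑ b, |copyKey d i b| ≤ 2 := by
  have hne : ∀ j : Fin L, j.castSucc ≠ Fin.last L := fun j => Fin.castSucc_ne_last j
  rw [Fin.sum_univ_add]
  simp only [copyKey, Fin.addCases_left, Fin.addCases_right, abs_zero, Finset.sum_const_zero,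
    zero_add, Pi.sub_apply]
  calc ∑ b, |(Pi.single i.castSucc 1 : Fin (L + 1) → ℝ) b - (Pi.single (Fin.last L) 1 :
        Fin (L + 1) → ℝ) b|
      ≤ ∑ b, (|(Pi.single i.castSucc 1 : Fin (L + 1) → ℝ) b| + |(Pi.single (Fin.last L) 1 :
        Fin (L + 1) → ℝ) b|) := Finset.sum_le_sum fun b _ => abs_sub _ _
    _ = 2 := by
      rw [Finset.sum_add_distrib]
      simp only [Pi.single_apply, apply_ite abs]
      simp
      norm_num

lemma sum_abs_copyQuery (d L : ℕ) : ∑ b, |copyQuery d L b| = L := by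
  rw [Fin.sum_univ_add]
  simp [copyQuery, Fin.sum_univ_castSucc]

lemma gatherLayer_WKQ_le {d : ℕ} (lam : ℝ) (src : Fin D → Fin (d + (L + 1)))
    (tok : Fin D → Fin L) (h : Fin (D * 2)) : frobNorm ((gatherLayer lam src tok).WKQ h) ≤ 2 * L := by
  unfold gatherLayer
  obtain ⟨j, hj | hj⟩ := pairLayer_WKQ _ _ _ _ h <;> rw [hj] <;>
    refine (frobNorm_vecMulVec_le _ _).trans ?_ <;>
    simp only [Pi.neg_apply, abs_neg, sum_abs_copyQuery] <;>
    exact mul_le_mul_of_nonneg_right (sum_abs_copyKey_le _) (Nat.cast_nonneg _)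

lemma gatherLayer_WV {d : ℕ} (hL : 0 < L) {lam : ℝ} (hlam : 1 ≤ lam)
    (src : Fin D → Fin (d + (L + 1))) (tok : Fin D → Fin L) (h : Fin (D * 2)) :
    frobNorm ((gatherLayer lam src tok).WV h) = (copyWeight L lam)⁻¹ := by
  unfold gatherLayer
  obtain ⟨j, hj⟩ := pairLayer_WV_single _ _ _ _ _ _ h
  rw [hj, abs_of_pos (inv_pos.2 (copyWeight_pos hL hlam))]

lemma gatherLayer_WKQ_pos {d : ℕ} (hL : 0 < L) (lam : ℝ) (src : Fin D → Fin (d + (L + 1)))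
    (tok : Fin D → Fin L) (h : Fin (D * 2)) :
    0 < frobNorm ((gatherLayer lam src tok).WKQ h) := by
  have hne : ∀ j : Fin L, j.castSucc ≠ Fin.last L := fun j => Fin.castSucc_ne_last j
  unfold gatherLayer
  obtain ⟨j, hj | hj⟩ := pairLayer_WKQ _ _ _ _ h <;> rw [hj] <;>
  · refine frobNorm_pos (i := Fin.natAdd d (Fin.last L)) (j := Fin.natAdd d (Fin.castSucc ⟨0, hL⟩))
      ?_
    rw [Matrix.vecMulVec_apply]
    simp only [copyKey, copyQuery, Fin.addCases_right, Pi.neg_apply, tokenMask_castSucc,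
      Pi.sub_apply, Pi.single_eq_same]
    simp [(hne _).symm]

lemma gateLayer_WKQ_le [Fintype T] {dout : ℕ} (e : Fin D ≃ Option (Fin n ⊕ T)) (hL : 0 < L)
    {lam B : ℝ} (hlam : 1 ≤ lam) (row : Fin D → Fin dout) (g : Option (Fin n ⊕ T) → Gate n)
    (hg : ∀ b, (g b).Bounded B) (h : Fin (D * 2)) :
    frobNorm ((gateLayer e L lam row g).WKQ h) ≤ B + L := by
  unfold gateLayer
  have hs : ∑ i : Fin D, |(Pi.single (e.symm none) 1 : Fin D → ℝ) i| = 1 := by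
    simp [Pi.single_apply, apply_ite abs]
  obtain ⟨j, hj | hj⟩ := pairLayer_WKQ _ _ _ _ h <;> rw [hj] <;>
    refine (frobNorm_vecMulVec_le _ _).trans ?_ <;> rw [hs, one_mul]
  · exact (sum_abs_affineQuery_le e hL hlam _ _).trans (by linarith [(hg (e j)).2.1])
  · exact (sum_abs_affineQuery_le e hL hlam _ _).trans (by linarith [(hg (e j)).2.2])

lemma gateLayer_WV_le {dout : ℕ} (e : Fin D ≃ Option (Fin n ⊕ T))
    {lam B : ℝ} (row : Fin D → Fin dout) (g : Option (Fin n ⊕ T) → Gate n)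
    (hg : ∀ b, (g b).Bounded B) (h : Fin (D * 2)) :
    frobNorm ((gateLayer e L lam row g).WV h) ≤ B := by
  unfold gateLayer
  obtain ⟨j, hj⟩ := pairLayer_WV_single _ _ _ _ _ _ h
  rw [hj]
  exact (hg (e j)).1

/-- Row of the preprocessed input that feeds a coordinate of the token content. -/
def sourceRow {d : ℕ} (hdL : L * d = n) (hL : 0 < L) : Option (Fin n ⊕ T) → Fin (d + (L + 1)) :=
  fun b => b.elim (Fin.natAdd d (Fin.castSucc ⟨0, hL⟩)) (Sum.elim
    (fun k => Fin.castAdd (L + 1) (finProdFinEquiv.symm (Fin.cast hdL.symm k)).2)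
    fun _ => Fin.natAdd d (Fin.castSucc ⟨0, hL⟩))

/-- Token of the preprocessed input that feeds a coordinate of the token content. -/
def sourceToken {d : ℕ} (hdL : L * d = n) (hL : 0 < L) : Option (Fin n ⊕ T) → Fin L :=
  fun b => b.elim ⟨0, hL⟩ (Sum.elim
    (fun k => (finProdFinEquiv.symm (Fin.cast hdL.symm k)).1) fun _ => ⟨0, hL⟩)

lemma preprocess_source {d : ℕ} (hdL : L * d = n) (hL : 0 < L) (e : Fin D ≃ Option (Fin n ⊕ T))
    (X : Matrix (Fin d) (Fin L) ℝ) (b : Fin D) :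
    preprocess X (sourceRow hdL hL (e b)) (sourceToken hdL hL (e b)).castSucc -
      preprocess X (sourceRow hdL hL (e b)) (Fin.last L) =
    stateVec e (vecCols hdL X) (fun _ => 1) b := by
  unfold stateVec
  rcases e b with _ | k | t
  · simp [sourceRow, sourceToken, preprocess, Matrix.one_apply, hL.ne']
  · simp [sourceRow, sourceToken, preprocess, vecCols]
  · simp [sourceRow, sourceToken, preprocess, Matrix.one_apply, hL.ne']

/-- Gates of the hidden layers: the constant and the input are passed on unchanged. -/
def hiddenGates (lam : ℝ) (g : T → Gate n) : Option (Fin n ⊕ T) → Gate n :=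
  fun b => b.elim (Gate.const n lam 1) (Sum.elim (fun _ => Gate.const n lam 1) g)

/-- Gates of the output layer: the products are weighted by `c`, everything else is dropped. -/
def outputGates (n : ℕ) (lam : ℝ) (c : T → ℝ) : Option (Fin n ⊕ T) → Gate n :=
  fun b => b.elim (Gate.const n lam 0) (Sum.elim (fun _ => Gate.const n lam 0)
    fun t => Gate.const n lam (c t))

/-- Attention-only Transformers compute sums of products of gates exactly. Each product is built up
in its own coordinate of the tokens, one factor per layer. -/
theorem exists_transformer_sum_prod [Fintype T] {d : ℕ} (hdL : L * d = n) (hn : 0 < n)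
    {lam B : ℝ} (hlam : 1 ≤ lam) (hB : 8 ≤ B) (K : ℕ) (c : T → ℝ) (g : ℕ → T → Gate n)
    (hc : ∀ t, 8 * |c t| ≤ B) (hg : ∀ s t, (g s t).Bounded B) :
    ∃ (W : ℕ) (CKQ CV : ℝ),
      ∃ G ∈ TransformerClass d L 1 ((Fintype.card T + n + 1) * 2) W (K + 2) CKQ CV lam,
        (∀ X i j, G X i j =
          ∑ t, c t * ∏ s ∈ Finset.range K, (g s t).eval lam (vecCols hdL X)) ∧
        W ≤ Fintype.card T + 2 * n + 1 ∧ CKQ ≤ B + 2 * n ∧ CV ≤ B + (n + 2) := by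
  have hL : 0 < L := Nat.pos_of_ne_zero (by rintro rfl; omega)
  have hd : 0 < d := Nat.pos_of_ne_zero (by rintro rfl; omega)
  have hLn : L ≤ n := by rw [← hdL]; exact Nat.le_mul_of_pos_right L hd
  have hdn : d + L ≤ n + 1 := by rw [← hdL]; nlinarith
  have hLn' : (L : ℝ) ≤ n := by exact_mod_cast hLn
  have hlam0 : 0 < lam := by linarith
  have hcard : Fintype.card (Option (Fin n ⊕ T)) = Fintype.card T + n + 1 := by
    simp [add_comm]
  set D := Fintype.card T + n + 1 with hD
  let e : Fin D ≃ Option (Fin n ⊕ T) := (Fintype.equivFinOfCardEq hcard).symm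
  let first := gatherLayer (d := d) lam (fun b => sourceRow hdL hL (e b))
    (fun b => sourceToken hdL hL (e b))
  let gate : ℕ → AttnLayer (D * 2) D D := fun s => gateLayer e L lam id (hiddenGates lam (g s))
  let out : AttnLayer (D * 2) D 1 := gateLayer e L lam (fun _ => 0) (outputGates n lam c)
  let S := (AttnStack.iterate first gate K).snoc out
  have h1 : (Gate.const n lam 1).Bounded B :=
    Gate.const_bounded n hlam (by linarith) (by simpa using hB)
  have h2 : (Gate.const n lam 0).Bounded B :=
    Gate.const_bounded n hlam (by linarith) (by simp; linarith)
  have hhid : ∀ s b, (hiddenGates lam (g s) b).Bounded B := by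
    rintro s (_ | k | t)
    exacts [h1, h1, hg s t]
  have hout : ∀ b, (outputGates n lam c b).Bounded B := by
    rintro (_ | k | t)
    exacts [h2, h2, Gate.const_bounded n hlam (by linarith) (hc t)]
  have hstate : ∀ (X : Matrix (Fin d) (Fin L) ℝ) (K : ℕ),
      (AttnStack.iterate first gate K).eval lam (preprocess X) = Matrix.vecMulVec
        (stateVec e (vecCols hdL X)
          fun t => ∏ s ∈ Finset.range K, (g s t).eval lam (vecCols hdL X)) (tokenMask L) := by
    intro X K
    induction K with
    | zero =>
      rw [AttnStack.iterate, AttnStack.eval_snoc, AttnStack.eval]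
      simp only [first]
      rw [gatherLayer_eval hL hlam]
      congr 1
      ext b
      rw [preprocess_source]
      simp
    | succ K ih =>
      rw [AttnStack.iterate, AttnStack.eval_snoc, ih]
      simp only [gate]
      rw [gateLayer_eval e hL hlam0]
      congr 1
      ext b
      simp only [id, Finset.sum_ite_eq', Finset.mem_univ, if_true]
      simp only [stateVec, hiddenGates]
      rcases e b with _ | k | t
      · simp [Gate.const_eval n hlam]
      · simp [Gate.const_eval n hlam]
      · simp [Finset.prod_range_succ, mul_comm]
  have hCKQmem : frobNorm (first.WKQ ⟨0, by omega⟩) ∈ S.keyQueryNorms := by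
    simp only [S, AttnStack.keyQueryNorms_snoc]
    exact Or.inl (AttnStack.keyQueryNorms_first_mem _ _ _ _)
  have hCVmem : frobNorm (first.WV ⟨0, by omega⟩) ∈ S.valueNorms := by
    simp only [S, AttnStack.valueNorms_snoc]
    exact Or.inl (AttnStack.valueNorms_first_mem _ _ _ _)
  have hdimmem : 1 ∈ S.dims := by
    simp only [S, AttnStack.dims_snoc]
    exact Or.inl (Or.inr rfl)
  obtain ⟨W, hW, hWmax⟩ := Set.exists_max_image _ id S.finite_dims ⟨_, hdimmem⟩
  obtain ⟨CKQ, hCKQ, hCKQmax⟩ := Set.exists_max_image _ id S.finite_keyQueryNorms ⟨_, hCKQmem⟩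
  obtain ⟨CV, hCV, hCVmax⟩ := Set.exists_max_image _ id S.finite_valueNorms ⟨_, hCVmem⟩
  refine ⟨W, CKQ, CV, fun X => truncate (S.eval lam (preprocess X)),
    ⟨hlam0, ?_, ?_, S, ?_, ⟨hW, fun _ h => hWmax _ h⟩, ⟨hCKQ, fun _ h => hCKQmax _ h⟩,
      ⟨hCV, fun _ h => hCVmax _ h⟩, fun _ => rfl⟩, ?_, ?_, ?_, ?_⟩
  · exact (gatherLayer_WKQ_pos hL _ _ _ _).trans_le (hCKQmax _ hCKQmem)
  · refine lt_of_lt_of_le ?_ (hCVmax _ hCVmem)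
    rw [gatherLayer_WV hL hlam]
    exact inv_pos.2 (copyWeight_pos hL hlam)
  · rw [AttnStack.depth_snoc, AttnStack.iterate_depth]
  · intro X i j
    simp only [S, truncate, Matrix.of_apply]
    rw [AttnStack.eval_snoc, hstate]
    simp only [out]
    rw [gateLayer_eval e hL hlam0, Matrix.vecMulVec_apply, tokenMask_castSucc, mul_one]
    simp only [Subsingleton.elim (0 : Fin 1) i, if_true, stateVec, outputGates]
    rw [Equiv.sum_comp e (fun b : Option (Fin n ⊕ T) => (b.elim (Gate.const n lam 0) (Sum.elim
      (fun _ => Gate.const n lam 0) fun t => Gate.const n lam (c t))).eval lam (vecCols hdL X) *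
      b.elim 1 (Sum.elim (vecCols hdL X)
        fun t => ∏ s ∈ Finset.range K, (g s t).eval lam (vecCols hdL X)))]
    simp [Fintype.sum_option, Fintype.sum_sum_type, Gate.const_eval n hlam]
  · simp only [S, AttnStack.dims_snoc] at hW
    rcases hW with (hW | hW) | ⟨i, hW⟩
    · rcases AttnStack.mem_dims_iterate _ _ hW with h | h | ⟨i, h⟩ | ⟨s, i, h⟩
      · omega
      · omega
      · change W = 1 at h; omega
      · change W = 1 at h; omega
    · change W = 1 at hW; omega
    · change 1 = W at hW; omega
  · simp only [S, AttnStack.keyQueryNorms_snoc] at hCKQ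
    rcases hCKQ with h | ⟨i, rfl⟩
    · rcases AttnStack.mem_keyQueryNorms_iterate _ _ h with ⟨i, rfl⟩ | ⟨s, i, rfl⟩
      · exact (gatherLayer_WKQ_le _ _ _ _).trans (by linarith)
      · exact (gateLayer_WKQ_le e hL hlam _ _ (hhid s) _).trans (by linarith)
    · exact (gateLayer_WKQ_le e hL hlam _ _ hout _).trans (by linarith)
  · simp only [S, AttnStack.valueNorms_snoc] at hCV
    have hn0 : (0 : ℝ) ≤ n := Nat.cast_nonneg n
    rcases hCV with h | ⟨i, rfl⟩
    · rcases AttnStack.mem_valueNorms_iterate _ _ h with ⟨i, rfl⟩ | ⟨s, i, rfl⟩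
      · rw [gatherLayer_WV hL hlam]
        exact (inv_copyWeight_le hL hlam).trans (by linarith)
      · exact (gateLayer_WV_le e _ _ (hhid s) _).trans (by linarith)
    · exact (gateLayer_WV_le e _ _ hout _).trans (by linarith)

end Network

/-! ### Iterated partial derivatives -/

section Derivatives

variable {n : ℕ}

/-- The iterated partial derivative `∂_{i_1} ⋯ ∂_{i_k} φ` for a list `[i_1, …, i_k]`. -/
def listD (l : List (Fin n)) (φ : (Fin n → ℝ) → ℝ) : (Fin n → ℝ) → ℝ := l.foldr partialD φ

@[simp] lemma listD_nil (φ : (Fin n → ℝ) → ℝ) : listD [] φ = φ := rfl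

@[simp] lemma listD_cons (i : Fin n) (l : List (Fin n)) (φ : (Fin n → ℝ) → ℝ) :
    listD (i :: l) φ = partialD i (listD l φ) := rfl

lemma contDiff_partialD {φ : (Fin n → ℝ) → ℝ} (h : ContDiff ℝ ∞ φ) (i : Fin n) :
    ContDiff ℝ ∞ (partialD i φ) :=
  (h.fderiv_right (m := ∞) (by simp)).clm_apply contDiff_const

lemma contDiff_listD {φ : (Fin n → ℝ) → ℝ} (h : ContDiff ℝ ∞ φ) (l : List (Fin n)) :
    ContDiff ℝ ∞ (listD l φ) := by
  induction l with
  | nil => exact h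
  | cons i l ih => exact contDiff_partialD ih i

lemma hasCompactSupport_listD {φ : (Fin n → ℝ) → ℝ} (h : HasCompactSupport φ) (l : List (Fin n)) :
    HasCompactSupport (listD l φ) := by
  induction l with
  | nil => exact h
  | cons i l ih => exact ih.fderiv_apply ℝ _

lemma partialD_comm {φ : (Fin n → ℝ) → ℝ} (h : ContDiff ℝ ∞ φ) (i j : Fin n) :
    partialD i (partialD j φ) = partialD j (partialD i φ) := by
  have h1 : ContDiff ℝ ∞ (fderiv ℝ φ) := h.fderiv_right (m := ∞) (by simp)
  have key : ∀ i j : Fin n, ∀ x, partialD i (partialD j φ) x =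
      fderiv ℝ (fderiv ℝ φ) x (Pi.single i 1) (Pi.single j 1) := by
    intro i j x
    have h2 : HasFDerivAt (fderiv ℝ φ) (fderiv ℝ (fderiv ℝ φ) x) x :=
      (h1.differentiable (by simp)).differentiableAt.hasFDerivAt
    have h3 := h2.clm_apply (hasFDerivAt_const (Pi.single j (1 : ℝ)) x)
    unfold partialD
    rw [h3.fderiv]
    simp
  ext x
  rw [key, key]
  exact (h.contDiffAt.isSymmSndFDerivAt (by
    rw [minSmoothness_of_isRCLikeNormedField]; exact WithTop.coe_le_coe.2 (le_top : (2 : ℕ∞) ≤ ⊤))) _ _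

lemma partialD_iterate_comm {φ : (Fin n → ℝ) → ℝ} (h : ContDiff ℝ ∞ φ) (i j : Fin n) (k : ℕ) :
    ContDiff ℝ ∞ ((partialD j)^[k] φ) ∧
      partialD i ((partialD j)^[k] φ) = (partialD j)^[k] (partialD i φ) := by
  induction k with
  | zero => exact ⟨h, rfl⟩
  | succ k ih =>
    rw [Function.iterate_succ_apply', Function.iterate_succ_apply', ← ih.2,
      partialD_comm ih.1]
    exact ⟨contDiff_partialD ih.1 j, rfl⟩

lemma partialD_multiD {φ : (Fin n → ℝ) → ℝ} (h : ContDiff ℝ ∞ φ) (i : Fin n) (α : Fin n → ℕ) :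
    multiD (α + Pi.single i 1) φ = partialD i (multiD α φ) := by
  have hsmooth : ∀ m : List (Fin n),
      ContDiff ℝ ∞ (m.foldr (fun i h => (partialD i)^[α i] h) φ) := by
    intro m
    induction m with
    | nil => exact h
    | cons a m ih => exact (partialD_iterate_comm ih a a _).1
  have hnot : ∀ m : List (Fin n), i ∉ m →
      m.foldr (fun j h => (partialD j)^[(α + Pi.single i 1 : Fin n → ℕ) j] h) φ =
        m.foldr (fun i h => (partialD i)^[α i] h) φ := by
    intro m
    induction m with
    | nil => exact fun _ => rfl
    | cons a m ih =>
      intro hm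
      rw [List.mem_cons, not_or] at hm
      rw [List.foldr_cons, List.foldr_cons, ih hm.2, Pi.add_apply,
        Pi.single_eq_of_ne (Ne.symm hm.1), add_zero]
  have hmem : ∀ m : List (Fin n), m.Nodup → i ∈ m →
      m.foldr (fun j h => (partialD j)^[(α + Pi.single i 1 : Fin n → ℕ) j] h) φ =
        partialD i (m.foldr (fun i h => (partialD i)^[α i] h) φ) := by
    intro m
    induction m with
    | nil => intro _ hm; simp at hm
    | cons a m ih =>
      intro hnd hm
      rw [List.nodup_cons] at hnd
      rw [List.foldr_cons, List.foldr_cons]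
      by_cases ha : a = i
      · subst ha
        rw [hnot m hnd.1, Pi.add_apply, Pi.single_eq_same, Function.iterate_succ_apply']
      · have : i ∈ m := by
          rcases List.mem_cons.1 hm with h' | h'
          · exact absurd h'.symm ha
          · exact h'
        rw [ih hnd.2 this, Pi.add_apply, Pi.single_eq_of_ne ha, add_zero,
          (partialD_iterate_comm (hsmooth m) i a _).2]
  exact hmem _ (List.nodup_finRange n) (List.mem_finRange i)

/-- On smooth functions the order of the partial derivatives does not matter. -/
lemma exists_listD_eq_multiD (l : List (Fin n)) : ∃ α : Fin n → ℕ, ∑ i, α i = l.length ∧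
    ∀ φ : (Fin n → ℝ) → ℝ, ContDiff ℝ ∞ φ → listD l φ = multiD α φ := by
  induction l with
  | nil =>
    refine ⟨0, by simp, fun φ _ => ?_⟩
    have : ∀ m : List (Fin n), φ = m.foldr
        (fun i h => (partialD i)^[(0 : Fin n → ℕ) i] h) φ := by
      intro m
      induction m with
      | nil => rfl
      | cons a m ih => rw [List.foldr_cons, ← ih]; rfl
    exact this _
  | cons i l ih =>
    obtain ⟨α, hα, h⟩ := ih
    refine ⟨α + Pi.single i 1, ?_, fun φ hφ => ?_⟩
    · simp [Finset.sum_add_distrib, hα]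
    · rw [listD_cons, h φ hφ, partialD_multiD hφ]

lemma listD_comp_affine {φ : (Fin n → ℝ) → ℝ} (h : ContDiff ℝ ∞ φ) (c : Fin n → ℝ) (s : ℝ)
    (l : List (Fin n)) :
    listD l (fun w => φ (c + s • w)) = fun w => s ^ l.length * listD l φ (c + s • w) := by
  induction l with
  | nil => simp
  | cons i l ih =>
    rw [listD_cons, ih]
    ext w
    have h1 : HasFDerivAt (fun w : Fin n → ℝ => c + s • w)
        (s • ContinuousLinearMap.id ℝ (Fin n → ℝ)) w :=
      ((hasFDerivAt_id w).const_smul s).const_add c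
    have h2 : HasFDerivAt (listD l φ) (fderiv ℝ (listD l φ) (c + s • w)) (c + s • w) :=
      ((contDiff_listD h l).differentiable (by simp)).differentiableAt.hasFDerivAt
    have h3 := (h2.comp w h1).const_mul (s ^ l.length)
    unfold partialD
    rw [show (fun w => s ^ l.length * listD l φ (c + s • w)) =
      (fun y => s ^ l.length * (listD l φ ∘ fun w => c + s • w) y) from rfl, h3.fderiv]
    simp [partialD]
    ring

end Derivatives

/-! ### Smoothing elements of the Sobolev ball -/

section Mollification

open MeasureTheory ContinuousLinearMap
open scoped Convolution

variable {n : ℕ}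

lemma isOpen_openCube (n : ℕ) : IsOpen (openCube n) := by
  have : openCube n = Set.univ.pi fun _ => Set.Ioo (0 : ℝ) 1 := by
    ext x; simp [openCube]
  rw [this]
  exact isOpen_set_pi Set.finite_univ fun _ _ => isOpen_Ioo

lemma openCube_subset_Icc (n : ℕ) : openCube n ⊆ Set.Icc 0 1 :=
  fun _ hx => ⟨fun i => (hx i).1.le, fun i => (hx i).2.le⟩

lemma listD_convolution {f ψ : (Fin n → ℝ) → ℝ} (hf : LocallyIntegrable f volume)
    (hψ : ContDiff ℝ ∞ ψ) (hc : HasCompactSupport ψ) (l : List (Fin n)) :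
    listD l (f ⋆[(lsmul ℝ ℝ : ℝ →L[ℝ] ℝ →L[ℝ] ℝ).flip, volume] ψ) =
      f ⋆[(lsmul ℝ ℝ : ℝ →L[ℝ] ℝ →L[ℝ] ℝ).flip, volume] listD l ψ := by
  induction l with
  | nil => rfl
  | cons i l ih =>
    rw [listD_cons, ih]
    ext x
    have h1 := contDiff_listD hψ l
    have h2 := hasCompactSupport_listD hc l
    unfold partialD
    rw [(h2.hasFDerivAt_convolution_right _ hf (h1.of_le (by simp)) x).fderiv,
      convolution_precompR_apply _ hf (h2.fderiv ℝ)
        (h1.continuous_fderiv (by simp))]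
    rfl

/-- If `f` lies in the Sobolev unit ball, its mollifications have derivatives bounded by `1`:
the derivatives can be moved from the mollifier to `f`. -/
lemma abs_listD_convolution_le {r : ℕ} {f ψ : (Fin n → ℝ) → ℝ} (hmem : MemSobolevUnitBall r f)
    (hf : LocallyIntegrable ((openCube n).indicator f) volume)
    (hψ : ContDiff ℝ ∞ ψ) (hc : HasCompactSupport ψ) (h0 : ∀ x, 0 ≤ ψ x) (h1 : ∫ x, ψ x = 1)
    (z : Fin n → ℝ) (hz : tsupport (fun w => ψ (z - w)) ⊆ openCube n) (l : List (Fin n))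
    (hl : l.length ≤ r) :
    |listD l ((openCube n).indicator f ⋆[(lsmul ℝ ℝ : ℝ →L[ℝ] ℝ →L[ℝ] ℝ).flip, volume] ψ) z| ≤
      1 := by
  obtain ⟨α, hα, hαeq⟩ := exists_listD_eq_multiD l
  obtain ⟨g, ⟨-, -, hg⟩, hg1⟩ := hmem α (hα.trans_le hl)
  have hae : ∀ᵐ x ∂(volume.restrict (openCube n)), ‖g x‖ ≤ 1 := by
    rw [eLpNorm_exponent_top] at hg1
    filter_upwards [ae_le_eLpNormEssSup (f := g) (μ := volume.restrict (openCube n))] with x hx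
    have := hx.trans hg1
    rw [← ofReal_norm] at this
    exact ENNReal.ofReal_le_one.1 this
  -- The reflected mollifier is the test function; the signs of the reflection and of the weak
  -- derivative cancel.
  set φ : (Fin n → ℝ) → ℝ := fun w => ψ (z - w) with hφ
  have hφ' : φ = fun w => ψ (z + (-1 : ℝ) • w) := by
    ext w; simp [hφ, sub_eq_add_neg]
  have hφs : ContDiff ℝ ∞ φ := hψ.comp (contDiff_const.sub contDiff_id)
  have hφc : HasCompactSupport φ := by
    have := hc.comp_homeomorph (Homeomorph.subLeft z)
    exact this
  have hφi : Integrable φ volume := hφs.continuous.integrable_of_hasCompactSupport hφc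
  have hφ1 : ∫ x, φ x = 1 := by
    rw [hφ, integral_sub_left_eq_self]; exact h1
  rw [listD_convolution hf hψ hc, convolution_def]
  have e1 : ∀ t, ((lsmul ℝ ℝ : ℝ →L[ℝ] ℝ →L[ℝ] ℝ).flip ((openCube n).indicator f t))
      (listD l ψ (z - t)) = (openCube n).indicator
        (fun t => (-1) ^ l.length * (f t * multiD α φ t)) t := by
    intro t
    have e2 : multiD α φ t = (-1) ^ l.length * listD l ψ (z - t) := by
      rw [← hαeq φ hφs, hφ', listD_comp_affine hψ]
      simp [sub_eq_add_neg]
    have e3 : ((-1 : ℝ) ^ l.length) * (-1) ^ l.length = 1 := by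
      rw [← mul_pow]; norm_num
    by_cases ht : t ∈ openCube n
    · simp only [Set.indicator_of_mem ht, flip_apply, lsmul_apply, smul_eq_mul]
      rw [e2]
      linear_combination (-(f t * listD l ψ (z - t))) * e3
    · simp [Set.indicator_of_notMem ht]
  simp only [e1]
  rw [integral_indicator (isOpen_openCube n).measurableSet, integral_const_mul,
    hg φ hφs hφc hz, hα, ← mul_assoc, ← mul_pow]
  norm_num
  calc |∫ x in openCube n, g x * φ x| ≤ ∫ x in openCube n, φ x := by
        rw [← Real.norm_eq_abs]
        refine norm_integral_le_of_norm_le hφi.integrableOn ?_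
        filter_upwards [hae] with x hx
        rw [norm_mul, Real.norm_of_nonneg (h0 (z - x))]
        exact mul_le_of_le_one_left (h0 _) hx
    _ ≤ ∫ x, φ x := setIntegral_le_integral hφi (Filter.Eventually.of_forall fun x => h0 _)
    _ = 1 := hφ1

/-- An element of the Sobolev unit ball is uniformly close to smooth functions with the same bounds
on the derivatives. The mollification is precomposed with a contraction of the cube, so that only
mollifiers supported inside the cube are used. -/
theorem exists_smooth_approx {r : ℕ} {f : (Fin n → ℝ) → ℝ} (hf : ContinuousOn f (Set.Icc 0 1))
    (hmem : MemSobolevUnitBall r f) {η : ℝ} (hη : 0 < η) :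
    ∃ g : (Fin n → ℝ) → ℝ, ContDiff ℝ ∞ g ∧
      (∀ l : List (Fin n), l.length ≤ r → ∀ x ∈ Set.Icc (0 : Fin n → ℝ) 1, |listD l g x| ≤ 1) ∧
      ∀ x ∈ Set.Icc (0 : Fin n → ℝ) 1, |g x - f x| ≤ η := by
  obtain ⟨δ, hδ, hunif⟩ := Metric.uniformContinuousOn_iff.1
    (isCompact_Icc.uniformContinuousOn_of_continuous hf) (η / 2) (by positivity)
  set F := (openCube n).indicator f with hF
  have hFi : Integrable F volume := by
    rw [hF, integrable_indicator_iff (isOpen_openCube n).measurableSet]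
    exact (hf.integrableOn_compact isCompact_Icc).mono_set (openCube_subset_Icc n)
  obtain ⟨h, hh0, hh1, hh2⟩ : ∃ h : ℝ, 0 < h ∧ h ≤ 1 / 4 ∧ h < δ :=
    ⟨min (1 / 4) (δ / 2), by positivity, min_le_left _ _,
      (min_le_right _ _).trans_lt (by linarith)⟩
  let ρ : ContDiffBump (0 : Fin n → ℝ) := ⟨h / 4, h / 2, by positivity, by linarith⟩
  set ψ := ρ.normed volume with hψ
  have hψs : ContDiff ℝ ∞ ψ := ρ.contDiff_normed
  have hψc : HasCompactSupport ψ := ρ.hasCompactSupport_normed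
  set G := F ⋆[(lsmul ℝ ℝ : ℝ →L[ℝ] ℝ →L[ℝ] ℝ).flip, volume] ψ with hG
  have hGs : ContDiff ℝ ∞ G := hψc.contDiff_convolution_right _ hFi.locallyIntegrable hψs
  -- The contraction `x ↦ c + s • x` maps the cube into the cube, with margin `h`.
  let c : Fin n → ℝ := fun _ => h
  let s : ℝ := 1 - 2 * h
  have hA : ∀ x ∈ Set.Icc (0 : Fin n → ℝ) 1, ∀ y, dist y (c + s • x) ≤ h / 2 → y ∈ openCube n := by
    intro x hx y hy i
    have h1 := (dist_pi_le_iff (by positivity)).1 hy i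
    rw [Real.dist_eq, abs_le] at h1
    have hx0 := hx.1 i
    have hx1 := hx.2 i
    simp only [Pi.add_apply, Pi.smul_apply, smul_eq_mul, c, s, Pi.zero_apply, Pi.one_apply]
      at h1 hx0 hx1
    constructor <;> nlinarith
  refine ⟨fun x => G (c + s • x), hGs.comp (contDiff_const.add (contDiff_id.const_smul s)), ?_, ?_⟩
  · intro l hl x hx
    rw [listD_comp_affine hGs]
    have h1 : |listD l G (c + s • x)| ≤ 1 := by
      refine abs_listD_convolution_le hmem hFi.locallyIntegrable hψs hψc ρ.nonneg_normed
        ρ.integral_normed _ ?_ l hl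
      refine (closure_minimal (t := Metric.closedBall (c + s • x) (h / 2)) ?_
        Metric.isClosed_closedBall).trans (fun y hy => hA x hx y hy)
      intro w hw
      have h2 : c + s • x - w ∈ Function.support ψ := hw
      rw [hψ, ρ.support_normed_eq, Metric.mem_ball, dist_zero_right] at h2
      rw [Metric.mem_closedBall, dist_comm, dist_eq_norm]
      exact h2.le
    rw [abs_mul, abs_pow]
    have hs : |s| ≤ 1 := by rw [abs_le]; constructor <;> simp only [s] <;> linarith
    exact mul_le_one₀ (pow_le_one₀ (abs_nonneg _) hs) (abs_nonneg _) h1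
  · intro x hx
    have hAx : c + s • x ∈ openCube n := hA x hx _ (by rw [dist_self]; positivity)
    have hAf : F (c + s • x) = f (c + s • x) := Set.indicator_of_mem hAx _
    have h1 : dist (G (c + s • x)) (F (c + s • x)) ≤ η / 2 := by
      rw [hG, convolution_flip]
      refine ρ.dist_normed_convolution_le hFi.aestronglyMeasurable fun y hy => ?_
      have hy' : dist y (c + s • x) < h / 2 := hy
      have hyc := hA x hx y hy'.le
      rw [hAf, show F y = f y from Set.indicator_of_mem hyc _]
      exact (hunif _ (openCube_subset_Icc n hyc) _ (openCube_subset_Icc n hAx)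
        (by linarith)).le
    have h2 : dist (f (c + s • x)) (f x) < η / 2 := by
      refine hunif _ (openCube_subset_Icc n hAx) _ hx (lt_of_le_of_lt ?_ hh2)
      refine (dist_pi_le_iff hh0.le).2 fun i => ?_
      have hx0 := hx.1 i
      have hx1 := hx.2 i
      simp only [Pi.zero_apply, Pi.one_apply] at hx0 hx1
      rw [Real.dist_eq, abs_le]
      simp only [Pi.add_apply, Pi.smul_apply, smul_eq_mul, c, s]
      constructor <;> nlinarith
    rw [← Real.dist_eq]
    rw [hAf] at h1
    linarith [dist_triangle (G (c + s • x)) (f (c + s • x)) (f x)]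

end Mollification

/-! ### Taylor expansion -/

section Taylor

variable {n : ℕ}

lemma listD_ofFn_cons {k : ℕ} (i : Fin n) (ι : Fin k → Fin n) (φ : (Fin n → ℝ) → ℝ) :
    listD (List.ofFn (Fin.cons i ι : Fin (k + 1) → Fin n)) φ =
      partialD i (listD (List.ofFn ι) φ) := by
  rw [List.ofFn_cons, listD_cons]

lemma clm_apply_eq_sum (A : (Fin n → ℝ) →L[ℝ] ℝ) (v : Fin n → ℝ) :
    A v = ∑ i, v i * A (Pi.single i 1) := by
  conv_lhs => rw [← Finset.univ_sum_single v, map_sum]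
  refine Finset.sum_congr rfl fun i _ => ?_
  rw [← smul_eq_mul, ← map_smul, ← Pi.single_smul', smul_eq_mul, mul_one]

/-- Derivatives along a segment in terms of iterated partial derivatives. -/
lemma iteratedDeriv_segment {g : (Fin n → ℝ) → ℝ} (hg : ContDiff ℝ ∞ g) (t v : Fin n → ℝ) (k : ℕ) :
    iteratedDeriv k (fun s : ℝ => g (t + s • v)) = fun s => ∑ ι : Fin k → Fin n,
      (∏ m, v (ι m)) * listD (List.ofFn ι) g (t + s • v) := by
  induction k with
  | zero => ext s; simp [iteratedDeriv_zero]
  | succ k ih =>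
    rw [iteratedDeriv_succ, ih]
    ext s
    have h1 : HasDerivAt (fun s : ℝ => t + s • v) v s := by
      simpa using ((hasDerivAt_id s).smul_const v).const_add t
    have h2 : ∀ ι : Fin k → Fin n, HasDerivAt
        (fun s : ℝ => (∏ m, v (ι m)) * listD (List.ofFn ι) g (t + s • v))
        ((∏ m, v (ι m)) * ∑ i, v i * partialD i (listD (List.ofFn ι) g) (t + s • v)) s := by
      intro ι
      have h3 : HasFDerivAt (listD (List.ofFn ι) g)
          (fderiv ℝ (listD (List.ofFn ι) g) (t + s • v)) (t + s • v) :=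
        ((contDiff_listD hg _).differentiable (by simp)).differentiableAt.hasFDerivAt
      have h4 := (h3.comp_hasDerivAt s h1).const_mul (∏ m, v (ι m))
      rw [clm_apply_eq_sum] at h4
      exact h4
    rw [(HasDerivAt.fun_sum fun ι _ => h2 ι).deriv]
    rw [← Equiv.sum_comp (Fin.consEquiv fun _ => Fin n), Fintype.sum_prod_type, Finset.sum_comm]
    refine Finset.sum_congr rfl fun ι _ => ?_
    rw [Finset.mul_sum]
    refine Finset.sum_congr rfl fun i _ => ?_
    rw [show (Fin.consEquiv fun _ => Fin n) (i, ι) = (Fin.cons i ι : Fin (k + 1) → Fin n) from rfl,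
      listD_ofFn_cons, Fin.prod_univ_succ]
    simp
    ring

/-- Taylor's theorem on the cube, with one term for each list of fewer than `r` coordinates. -/
theorem abs_sub_taylor_le {r : ℕ} (hr : 0 < r) {g : (Fin n → ℝ) → ℝ} (hg : ContDiff ℝ ∞ g)
    (hD : ∀ l : List (Fin n), l.length ≤ r → ∀ x ∈ Set.Icc (0 : Fin n → ℝ) 1, |listD l g x| ≤ 1)
    {t x : Fin n → ℝ} (ht : t ∈ Set.Icc (0 : Fin n → ℝ) 1) (hx : x ∈ Set.Icc (0 : Fin n → ℝ) 1)
    {h : ℝ} (hh : ∀ i, |x i - t i| ≤ h) :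
    |g x - ∑ k ∈ Finset.range r, ∑ ι : Fin k → Fin n,
      ((k.factorial : ℝ)⁻¹ * listD (List.ofFn ι) g t) * ∏ m, (x (ι m) - t (ι m))| ≤
      n ^ r * h ^ r := by
  obtain ⟨r, rfl⟩ := Nat.exists_eq_succ_of_ne_zero hr.ne'
  set v := x - t with hv
  set u : ℝ → ℝ := fun s => g (t + s • v) with hu
  have hus : ContDiff ℝ ∞ u := hg.comp (contDiff_const.add (contDiff_id.smul contDiff_const))
  have heq : ∀ k, ∀ s ∈ Set.Icc (0 : ℝ) 1, iteratedDerivWithin k u (Set.Icc 0 1) s =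
      ∑ ι : Fin k → Fin n, (∏ m, v (ι m)) * listD (List.ofFn ι) g (t + s • v) := by
    intro k s hs
    rw [iteratedDerivWithin_eq_iteratedDeriv (uniqueDiffOn_Icc zero_lt_one)
      (hus.contDiffAt.of_le (by exact WithTop.coe_le_coe.2 le_top)) hs, hu,
      iteratedDeriv_segment hg]
  have hseg : ∀ s ∈ Set.Icc (0 : ℝ) 1, t + s • v ∈ Set.Icc (0 : Fin n → ℝ) 1 := by
    intro s hs
    refine ⟨fun i => ?_, fun i => ?_⟩
    · have h1 := ht.1 i
      have h2 := hx.1 i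
      simp only [hv, Pi.add_apply, Pi.smul_apply, Pi.sub_apply, smul_eq_mul, Pi.zero_apply] at *
      nlinarith [hs.1, hs.2]
    · have h1 := ht.2 i
      have h2 := hx.2 i
      simp only [hv, Pi.add_apply, Pi.smul_apply, Pi.sub_apply, smul_eq_mul, Pi.one_apply] at *
      nlinarith [hs.1, hs.2]
  have hC : ∀ s ∈ Set.Icc (0 : ℝ) 1, ‖iteratedDerivWithin (r + 1) u (Set.Icc 0 1) s‖ ≤
      (n : ℝ) ^ (r + 1) * h ^ (r + 1) := by
    intro s hs
    rw [heq _ s hs]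
    refine (norm_sum_le _ _).trans ?_
    calc ∑ ι : Fin (r + 1) → Fin n, ‖(∏ m, v (ι m)) * listD (List.ofFn ι) g (t + s • v)‖
        ≤ ∑ _ι : Fin (r + 1) → Fin n, h ^ (r + 1) := by
          refine Finset.sum_le_sum fun ι _ => ?_
          rw [norm_mul, Real.norm_eq_abs, Real.norm_eq_abs, Finset.abs_prod]
          have h1 : ∏ m, |v (ι m)| ≤ h ^ (r + 1) := by
            refine (Finset.prod_le_prod (fun _ _ => abs_nonneg _) fun m _ => hh (ι m)).trans ?_
            simp
          have h2 := hD (List.ofFn ι) (by simp) _ (hseg s hs)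
          have h3 : 0 ≤ ∏ m, |v (ι m)| := Finset.prod_nonneg fun _ _ => abs_nonneg _
          exact (mul_le_of_le_one_right h3 h2).trans h1
      _ = (n : ℝ) ^ (r + 1) * h ^ (r + 1) := by simp
  have hT := taylor_mean_remainder_bound (f := u) (n := r) zero_le_one
    (hus.contDiffOn.of_le (by exact WithTop.coe_le_coe.2 le_top))
    (Set.right_mem_Icc.2 zero_le_one) hC
  have hux : u 1 = g x := by simp [hu, hv]
  rw [hux, taylor_within_apply, Real.norm_eq_abs] at hT
  have hsum : ∑ k ∈ Finset.range (r + 1), (((k.factorial : ℝ)⁻¹ * (1 - 0) ^ k) •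
      iteratedDerivWithin k u (Set.Icc 0 1) 0) = ∑ k ∈ Finset.range (r + 1), ∑ ι : Fin k → Fin n,
      ((k.factorial : ℝ)⁻¹ * listD (List.ofFn ι) g t) * ∏ m, (x (ι m) - t (ι m)) := by
    refine Finset.sum_congr rfl fun k _ => ?_
    rw [heq k 0 (Set.left_mem_Icc.2 zero_le_one), smul_eq_mul, Finset.mul_sum]
    refine Finset.sum_congr rfl fun ι _ => ?_
    simp [hv]
    ring
  rw [hsum] at hT
  have hfac : (1 : ℝ) ≤ r.factorial := by exact_mod_cast r.factorial_pos
  refine hT.trans ?_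
  rw [sub_zero, one_pow, mul_one]
  refine div_le_self ?_ hfac
  exact (norm_nonneg _).trans (hC 0 (Set.left_mem_Icc.2 zero_le_one))

end Taylor

/-! ### Sigmoid estimates -/

section Sigmoid

lemma abs_sigmoid_sub_half_le (z : ℝ) : |Real.sigmoid z - 1 / 2| ≤ |z| / 4 := by
  have h : ∀ y ∈ (Set.univ : Set ℝ), ‖deriv Real.sigmoid y‖ ≤ 1 / 4 := by
    intro y _
    rw [Real.deriv_sigmoid, Real.norm_eq_abs, abs_le]
    have h1 := Real.sigmoid_nonneg y
    have h2 := Real.sigmoid_le_one y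
    constructor
    · nlinarith
    · nlinarith [sq_nonneg (Real.sigmoid y - 1 / 2)]
  have := Convex.norm_image_sub_le_of_norm_deriv_le (fun y _ => differentiableAt_sigmoid) h
    convex_univ (Set.mem_univ 0) (Set.mem_univ z)
  rw [Real.sigmoid_zero, sub_zero, Real.norm_eq_abs, Real.norm_eq_abs] at this
  rw [one_div]
  linarith

lemma abs_four_mul_sigmoid_sub_le {z : ℝ} (hz : |z| ≤ 1) :
    |4 * (Real.sigmoid z - 1 / 2) - z| ≤ z ^ 2 := by
  have hd : ∀ y, HasDerivAt (fun y => 4 * (Real.sigmoid y - 1 / 2) - y)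
      (4 * (Real.sigmoid y * (1 - Real.sigmoid y)) - 1) y := fun y =>
    (((Real.hasDerivAt_sigmoid y).sub_const _).const_mul 4).sub (hasDerivAt_id y)
  have h : ∀ y ∈ Set.uIcc 0 z, ‖4 * (Real.sigmoid y * (1 - Real.sigmoid y)) - 1‖ ≤ |z| := by
    intro y hy
    have hy' : |y| ≤ |z| := by
      have := Set.abs_sub_left_of_mem_uIcc hy
      simpa using this
    have h1 := abs_sigmoid_sub_half_le y
    have h2 : (Real.sigmoid y - 1 / 2) ^ 2 ≤ (|y| / 4) ^ 2 := by
      rw [← sq_abs]; exact pow_le_pow_left₀ (abs_nonneg _) h1 2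
    rw [Real.norm_eq_abs, abs_le]
    constructor <;> nlinarith [abs_nonneg y, abs_nonneg z, sq_nonneg (Real.sigmoid y - 1 / 2)]
  have := Convex.norm_image_sub_le_of_norm_hasDerivWithin_le
    (fun y _ => (hd y).hasDerivWithinAt) h (convex_uIcc 0 z) Set.left_mem_uIcc Set.right_mem_uIcc
  rw [Real.sigmoid_zero] at this
  norm_num at this ⊢
  rw [sq]
  exact this

/-- The rescaled sigmoid `(4 / τ) (sigmoid (τ v) - 1 / 2)` is nearly the identity. -/
lemma abs_rescaled_sigmoid_sub_le {τ v : ℝ} (h0 : 0 < τ) (h1 : τ ≤ 1) (hv : |v| ≤ 1) :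
    |4 / τ * (Real.sigmoid (τ * v) - 1 / 2) - v| ≤ τ := by
  have hv2 : v ^ 2 ≤ 1 := by rw [← sq_abs]; exact pow_le_one₀ (abs_nonneg _) hv
  have h := abs_four_mul_sigmoid_sub_le (z := τ * v) (by
    rw [abs_mul, abs_of_pos h0]; exact mul_le_one₀ h1 (abs_nonneg _) hv)
  have : 4 / τ * (Real.sigmoid (τ * v) - 1 / 2) - v =
      (4 * (Real.sigmoid (τ * v) - 1 / 2) - τ * v) / τ := by field_simp
  rw [this, abs_div, abs_of_pos h0, div_le_iff₀ h0]
  refine h.trans ?_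
  nlinarith [mul_pos h0 h0]

lemma abs_rescaled_sigmoid_le {τ v : ℝ} (h0 : 0 < τ) (hv : |v| ≤ 1) :
    |4 / τ * (Real.sigmoid (τ * v) - 1 / 2)| ≤ 1 := by
  have h := abs_sigmoid_sub_half_le (τ * v)
  rw [abs_mul, abs_of_pos h0] at h
  rw [abs_mul, abs_of_pos (by positivity), div_mul_eq_mul_div, div_le_one h0]
  nlinarith

lemma sigmoid_neg_le_exp (z : ℝ) : Real.sigmoid (-z) ≤ Real.exp (-z) := by
  rw [Real.sigmoid_def, neg_neg, Real.exp_neg]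
  exact inv_anti₀ (Real.exp_pos z) (by linarith)

/-- Products of numbers of absolute value at most `1` are stable under perturbations. -/
lemma abs_prod_sub_prod_le {ι : Type*} (s : Finset ι) (u v : ι → ℝ) {τ : ℝ}
    (hu : ∀ i, |u i| ≤ 1) (hv : ∀ i, |v i| ≤ 1) (h : ∀ i, |u i - v i| ≤ τ) :
    |∏ i ∈ s, u i - ∏ i ∈ s, v i| ≤ s.card * τ := by
  classical
  induction s using Finset.induction_on with
  | empty => simp
  | insert a s ha ih =>
    rw [Finset.prod_insert ha, Finset.prod_insert ha, Finset.card_insert_of_notMem ha]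
    have hp : |∏ i ∈ s, u i| ≤ 1 := by
      rw [Finset.abs_prod]; exact Finset.prod_le_one (fun _ _ => abs_nonneg _) fun i _ => hu i
    have e : u a * ∏ i ∈ s, u i - v a * ∏ i ∈ s, v i =
        (u a - v a) * ∏ i ∈ s, u i + v a * (∏ i ∈ s, u i - ∏ i ∈ s, v i) := by ring
    rw [e]
    refine (abs_add_le _ _).trans ?_
    rw [abs_mul, abs_mul]
    have h1 : |u a - v a| * |∏ i ∈ s, u i| ≤ τ :=
      (mul_le_of_le_one_right (abs_nonneg _) hp).trans (h a)
    have h2 : |v a| * |∏ i ∈ s, u i - ∏ i ∈ s, v i| ≤ s.card * τ :=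
      (mul_le_of_le_one_left (abs_nonneg _) (hv a)).trans ih
    push_cast
    linarith

end Sigmoid

/-! ### A partition of unity by sigmoid differences -/

section Partition

/-- The bump around the interval `[(j - 1) / N, j / N]`, with steepness `N * B`. -/
def bump (N : ℕ) (B : ℝ) (j : ℕ) (x : ℝ) : ℝ :=
  Real.sigmoid (B * (N * x + 1 - j)) - Real.sigmoid (B * (N * x - j))

/-- The point of `[0, 1]` closest to `(j - 1) / N`. -/
def center (N j : ℕ) : ℝ := max 0 (min 1 (((j : ℝ) - 1) / N))

lemma center_mem (N j : ℕ) : center N j ∈ Set.Icc (0 : ℝ) 1 :=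
  ⟨le_max_left _ _, max_le zero_le_one (min_le_left _ _)⟩

lemma abs_sub_center_le {N : ℕ} (j : ℕ) {x : ℝ} (hx : x ∈ Set.Icc (0 : ℝ) 1) :
    |x - center N j| ≤ |x - ((j : ℝ) - 1) / N| := by
  have : x = max 0 (min 1 x) := by rw [min_eq_right hx.2, max_eq_right hx.1]
  unfold center
  conv_lhs => rw [this]
  refine (abs_max_sub_max_le_max _ _ _ _).trans ?_
  rw [sub_self, abs_zero, max_eq_right (abs_nonneg _)]
  refine (abs_min_sub_min_le_max _ _ _ _).trans ?_
  rw [sub_self, abs_zero, max_eq_right (abs_nonneg _)]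

lemma bump_nonneg (N : ℕ) {B : ℝ} (hB : 0 ≤ B) (j : ℕ) (x : ℝ) : 0 ≤ bump N B j x :=
  sub_nonneg.2 (Real.sigmoid_le (mul_le_mul_of_nonneg_left (by linarith) hB))

lemma bump_le_one (N : ℕ) (B : ℝ) (j : ℕ) (x : ℝ) : bump N B j x ≤ 1 := by
  unfold bump
  linarith [Real.sigmoid_le_one (B * (N * x + 1 - j)), Real.sigmoid_nonneg (B * (N * x - j))]

lemma sigmoid_le_exp_of_le_neg {B z : ℝ} (h : z ≤ -B) : Real.sigmoid z ≤ Real.exp (-B) :=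
  (Real.sigmoid_le h).trans (sigmoid_neg_le_exp B)

lemma one_sub_sigmoid_le_exp_of_le {B z : ℝ} (h : B ≤ z) : 1 - Real.sigmoid z ≤ Real.exp (-B) := by
  rw [← Real.sigmoid_neg]
  exact sigmoid_le_exp_of_le_neg (neg_le_neg h)

/-- Away from its center, a bump is exponentially small. -/
lemma bump_le_exp {N : ℕ} (hN : 0 < N) {B : ℝ} (hB : 0 ≤ B) (j : ℕ) {x : ℝ}
    (hx : x ∈ Set.Icc (0 : ℝ) 1) (hfar : 2 / N < |x - center N j|) :
    bump N B j x ≤ Real.exp (-B) := by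
  have hN' : (0 : ℝ) < N := by exact_mod_cast hN
  have h := hfar.trans_le (abs_sub_center_le j hx)
  have h' : 2 < |N * x - (j - 1)| := by
    rw [div_lt_iff₀ hN', ← abs_of_pos hN', ← abs_mul, abs_of_pos hN'] at h
    rwa [sub_mul, div_mul_cancel₀ _ hN'.ne', mul_comm x] at h
  unfold bump
  rcases lt_abs.1 h' with h | h
  · have h1 := one_sub_sigmoid_le_exp_of_le (B := B) (z := B * (N * x - j)) (by nlinarith)
    linarith [Real.sigmoid_le_one (B * (N * x + 1 - j))]
  · have h1 := sigmoid_le_exp_of_le_neg (B := B) (z := B * (N * x + 1 - j)) (by nlinarith)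
    linarith [Real.sigmoid_nonneg (B * (N * x - j))]

lemma sum_bump (N : ℕ) (B x : ℝ) : ∑ j : Fin (N + 2), bump N B j x =
    Real.sigmoid (B * (N * x + 1)) - Real.sigmoid (B * (N * x - (N + 1))) := by
  rw [Fin.sum_univ_eq_sum_range (fun j : ℕ => bump N B j x) (N + 2)]
  have h : ∀ j : ℕ, bump N B j x = Real.sigmoid (B * (N * x + 1 - j)) -
      Real.sigmoid (B * (N * x + 1 - (j + 1 : ℕ))) := by
    intro j
    unfold bump
    push_cast
    ring_nf
  rw [Finset.sum_congr rfl fun j _ => h j,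
    Finset.sum_range_sub' (fun j : ℕ => Real.sigmoid (B * (N * x + 1 - j)))]
  push_cast
  ring_nf

lemma abs_sum_bump_sub_one_le {N : ℕ} {B x : ℝ} (hB : 0 ≤ B) (hx : x ∈ Set.Icc (0 : ℝ) 1) :
    |∑ j : Fin (N + 2), bump N B j x - 1| ≤ 2 * Real.exp (-B) := by
  have hN' : (0 : ℝ) ≤ N := Nat.cast_nonneg N
  rw [sum_bump]
  have h0 : 0 ≤ N * x := mul_nonneg hN' hx.1
  have h0' : N * x ≤ N := mul_le_of_le_one_right hN' hx.2
  have h1 := one_sub_sigmoid_le_exp_of_le (B := B) (z := B * (N * x + 1)) (by nlinarith)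
  have h2 := sigmoid_le_exp_of_le_neg (B := B) (z := B * (N * x - (N + 1))) (by nlinarith)
  have h3 := Real.sigmoid_le_one (B * (N * x + 1))
  have h4 := Real.sigmoid_nonneg (B * (N * x - (N + 1)))
  have h5 := Real.exp_pos (-B)
  rw [abs_le]
  constructor <;> linarith

lemma sum_bump_le_one (N : ℕ) (B x : ℝ) : ∑ j : Fin (N + 2), bump N B j x ≤ 1 := by
  rw [sum_bump]
  linarith [Real.sigmoid_le_one (B * (N * x + 1)),
    Real.sigmoid_nonneg (B * (N * x - (N + 1)))]

variable {n : ℕ}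

/-- The product bumps form a partition of unity up to an exponentially small error, so local
approximations of order `r` are glued to a global one. -/
lemma abs_sum_prod_bump_mul_sub_le {N : ℕ} (hN : 0 < N) {B : ℝ} (hB : 0 ≤ B) {r : ℕ}
    {x : Fin n → ℝ} (hx : x ∈ Set.Icc (0 : Fin n → ℝ) 1) {y A Q : ℝ} (hy : |y| ≤ 1) (hQ : 0 ≤ Q)
    (hA : 0 ≤ A) (p : (Fin n → Fin (N + 2)) → ℝ)
    (hp : ∀ j, ∀ h : ℝ, (∀ i, |x i - center N (j i)| ≤ h) → |p j - y| ≤ A + Q * h ^ r) :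
    |∑ j, (∏ i, bump N B (j i) (x i)) * p j - y| ≤
      A + Q * (2 / N) ^ r + Q * ((N + 2) ^ n * Real.exp (-B)) + 2 * n * Real.exp (-B) := by
  have hxi : ∀ i, x i ∈ Set.Icc (0 : ℝ) 1 := fun i => ⟨hx.1 i, hx.2 i⟩
  have hΦ0 : ∀ j : Fin n → Fin (N + 2), 0 ≤ ∏ i, bump N B (j i) (x i) := fun j =>
    Finset.prod_nonneg fun i _ => bump_nonneg N hB _ _
  have hE := Real.exp_pos (-B)
  have hsum : ∑ j : Fin n → Fin (N + 2), ∏ i, bump N B (j i) (x i) =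
      ∏ i, ∑ j : Fin (N + 2), bump N B j (x i) := by
    rw [Finset.prod_univ_sum, Fintype.piFinset_univ]
  have hS0 : ∀ i, 0 ≤ ∑ j : Fin (N + 2), bump N B j (x i) := fun i =>
    Finset.sum_nonneg fun j _ => bump_nonneg N hB _ _
  have hsum1 : ∑ j : Fin n → Fin (N + 2), ∏ i, bump N B (j i) (x i) ≤ 1 := by
    rw [hsum]
    exact Finset.prod_le_one (fun i _ => hS0 i) fun i _ => sum_bump_le_one N B (x i)
  have hsum2 : |∑ j : Fin n → Fin (N + 2), ∏ i, bump N B (j i) (x i) - 1| ≤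
      2 * n * Real.exp (-B) := by
    rw [hsum]
    have := abs_prod_sub_prod_le (τ := 2 * Real.exp (-B)) Finset.univ
      (fun i => ∑ j : Fin (N + 2), bump N B j (x i)) (fun _ => 1)
      (fun i => by rw [abs_of_nonneg (hS0 i)]; exact sum_bump_le_one N B (x i))
      (fun _ => by simp) (fun i => abs_sum_bump_sub_one_le hB (hxi i))
    simp only [Finset.prod_const_one, Finset.card_univ, Fintype.card_fin] at this
    linarith
  have hterm : ∀ j : Fin n → Fin (N + 2), |(∏ i, bump N B (j i) (x i)) * (p j - y)| ≤
      (∏ i, bump N B (j i) (x i)) * (A + Q * (2 / N) ^ r) + Q * Real.exp (-B) := by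
    intro j
    rw [abs_mul, abs_of_nonneg (hΦ0 j)]
    -- On near cells the local error is small, on far cells the bump is.
    by_cases hnear : ∀ i, |x i - center N (j i)| ≤ 2 / N
    · have := mul_le_mul_of_nonneg_left (hp j _ hnear) (hΦ0 j)
      linarith [mul_nonneg hQ hE.le]
    · push Not at hnear
      obtain ⟨i, hi⟩ := hnear
      have h1 : ∏ i, bump N B (j i) (x i) ≤ Real.exp (-B) := by
        rw [← Finset.mul_prod_erase _ _ (Finset.mem_univ i)]
        refine (mul_le_of_le_one_right (bump_nonneg N hB _ _) ?_).trans
          (bump_le_exp hN hB _ (hxi i) hi)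
        exact Finset.prod_le_one (fun i _ => bump_nonneg N hB _ _) fun i _ => bump_le_one N B _ _
      have h2 := hp j 1 fun i => by
        have := center_mem N (j i)
        rw [abs_le]
        constructor <;> linarith [(hxi i).1, (hxi i).2, this.1, this.2]
      rw [one_pow, mul_one] at h2
      have h3 := mul_le_mul_of_nonneg_left h2 (hΦ0 j)
      have h4 : 0 ≤ Q * (2 / (N : ℝ)) ^ r := by positivity
      nlinarith [mul_nonneg (hΦ0 j) h4, mul_le_mul_of_nonneg_left h1 hQ]
  have hsplit : ∑ j, (∏ i, bump N B (j i) (x i)) * p j - y =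
      ∑ j, (∏ i, bump N B (j i) (x i)) * (p j - y) +
        (∑ j : Fin n → Fin (N + 2), ∏ i, bump N B (j i) (x i) - 1) * y := by
    simp only [mul_sub, Finset.sum_sub_distrib, ← Finset.sum_mul]
    ring
  rw [hsplit]
  refine (abs_add_le _ _).trans ?_
  have h1 : |(∑ j : Fin n → Fin (N + 2), ∏ i, bump N B (j i) (x i) - 1) * y| ≤
      2 * n * Real.exp (-B) := by
    rw [abs_mul]
    exact (mul_le_of_le_one_right (abs_nonneg _) hy).trans hsum2
  have h2 : |∑ j, (∏ i, bump N B (j i) (x i)) * (p j - y)| ≤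
      A + Q * (2 / N) ^ r + Q * ((N + 2) ^ n * Real.exp (-B)) := by
    refine (Finset.abs_sum_le_sum_abs _ _).trans ((Finset.sum_le_sum fun j _ => hterm j).trans ?_)
    rw [Finset.sum_add_distrib, ← Finset.sum_mul, Finset.sum_const, Finset.card_univ]
    have h3 : 0 ≤ A + Q * (2 / (N : ℝ)) ^ r := by positivity
    have h4 := mul_le_of_le_one_left h3 hsum1
    simp only [Fintype.card_fun, Fintype.card_fin, nsmul_eq_mul, Nat.cast_pow, Nat.cast_add,
      Nat.cast_ofNat]
    linarith
  linarith

end Partition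

/-! ### The approximating Transformer -/

section Approximation

variable {n : ℕ}

/-- The index set of the monomials of degree less than `r`, written as ordered products of
coordinates. -/
abbrev Monomial (n r : ℕ) : Type := Σ k : Fin r, (Fin k → Fin n)

/-- The gate computing the bump `j` of the coordinate `i` at inverse temperature `N * B`. -/
def bumpGate (N j : ℕ) (i : Fin n) : Gate n where
  scale := 1
  a := (1 - j) / N
  w := Pi.single i 1
  a' := -j / N
  w' := Pi.single i 1

/-- The gate computing `sigmoid (τ * (x i - t)) - 1 / 2`. -/
def factorGate (lam τ t : ℝ) (i : Fin n) : Gate n where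
  scale := 1
  a := -(τ / lam * t)
  w := Pi.single i (τ / lam)
  a' := 0
  w' := 0

lemma bumpGate_eval {N : ℕ} (hN : 0 < N) (B : ℝ) (j : ℕ) (i : Fin n) (x : Fin n → ℝ) :
    (bumpGate N j i).eval (N * B) x = bump N B j (x i) := by
  have hN' : (N : ℝ) ≠ 0 := by exact_mod_cast hN.ne'
  simp only [Gate.eval, bumpGate, single_one_dotProduct, one_mul, bump]
  congr 2 <;> field_simp <;> ring

lemma factorGate_eval {lam : ℝ} (hlam : 0 < lam) (τ t : ℝ) (i : Fin n) (x : Fin n → ℝ) :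
    (factorGate lam τ t i).eval lam x = Real.sigmoid (τ * (x i - t)) - 1 / 2 := by
  simp only [Gate.eval, factorGate, single_dotProduct, one_mul, zero_dotProduct, add_zero, mul_zero,
    Real.sigmoid_zero]
  rw [one_div]
  congr 2
  field_simp
  ring

lemma sum_abs_single (i : Fin n) (a : ℝ) : ∑ k, |(Pi.single i a : Fin n → ℝ) k| = |a| := by
  rw [Finset.sum_eq_single i]
  · simp
  · intro k _ hk; simp [hk]
  · simp

lemma bumpGate_bounded {N : ℕ} (hN : 0 < N) {j : ℕ} (hj : j ≤ N + 1) (i : Fin n) {B : ℝ}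
    (hB : 3 ≤ B) : (bumpGate N j i).Bounded B := by
  have hN' : (1 : ℝ) ≤ N := by exact_mod_cast hN
  have hj' : (j : ℝ) ≤ N + 1 := by exact_mod_cast hj
  have hj0 : (0 : ℝ) ≤ j := Nat.cast_nonneg j
  refine ⟨?_, ?_, ?_⟩
  · simp [bumpGate]; linarith
  · simp only [bumpGate, sum_abs_single, abs_one]
    have : |(1 - (j : ℝ)) / N| ≤ 2 := by
      rw [abs_div, Nat.abs_cast, div_le_iff₀ (by linarith), abs_le]
      constructor <;> linarith
    linarith
  · simp only [bumpGate, sum_abs_single, abs_one]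
    have : |-(j : ℝ) / N| ≤ 2 := by
      rw [abs_div, Nat.abs_cast, div_le_iff₀ (by linarith), abs_le]
      constructor <;> linarith
    linarith

lemma factorGate_bounded {lam τ t : ℝ} (hlam : 1 ≤ lam) (h0 : 0 ≤ τ) (h1 : τ ≤ 1)
    (ht : t ∈ Set.Icc (0 : ℝ) 1) (i : Fin n) {B : ℝ} (hB : 2 ≤ B) :
    (factorGate lam τ t i).Bounded B := by
  have h2 : τ / lam ≤ 1 := (div_le_self h0 hlam).trans h1
  have h3 : 0 ≤ τ / lam := by positivity
  refine ⟨?_, ?_, ?_⟩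
  · simp [factorGate]; linarith
  · simp only [factorGate, sum_abs_single, abs_neg]
    rw [abs_of_nonneg (mul_nonneg h3 ht.1), abs_of_nonneg h3]
    nlinarith [ht.1, ht.2]
  · simp [factorGate]; linarith

/-- The factors of the product attached to a cell `j` and a monomial: first the bumps of the cell,
then the factors of the monomial, then amplification by a constant in each of the remaining
layers. -/
def termGate {N r : ℕ} (lam τ : ℝ) (s : ℕ) (q : (Fin n → Fin (N + 2)) × Monomial n r) : Gate n :=
  if h : s < n then bumpGate N (q.1 ⟨s, h⟩) ⟨s, h⟩
  else if h : s - n < q.2.1 then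
    factorGate lam τ (center N (q.1 (q.2.2 ⟨s - n, h⟩))) (q.2.2 ⟨s - n, h⟩)
  else if s < n + r then Gate.const n lam 1
  else Gate.const n lam (2 ^ (q.2.1 : ℕ))

lemma termGate_bounded {N r : ℕ} (hN : 0 < N) {lam τ : ℝ} (hlam : 1 ≤ lam) (h0 : 0 ≤ τ)
    (h1 : τ ≤ 1) (s : ℕ) (q : (Fin n → Fin (N + 2)) × Monomial n r) :
    (termGate lam τ s q).Bounded (8 * 2 ^ r) := by
  have hr : (1 : ℝ) ≤ 2 ^ r := one_le_pow₀ (by norm_num)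
  unfold termGate
  split_ifs with h h' h''
  · exact bumpGate_bounded hN (Nat.lt_succ_iff.1 (q.1 _).2) _ (by linarith)
  · exact factorGate_bounded hlam h0 h1 (center_mem _ _) _ (by linarith)
  · exact Gate.const_bounded n hlam (by linarith) (by simpa using hr)
  · refine Gate.const_bounded n hlam (by linarith) ?_
    rw [abs_of_pos (by positivity)]
    exact mul_le_mul_of_nonneg_left (pow_le_pow_right₀ (by norm_num) q.2.1.2.le) (by norm_num)

lemma prod_termGate_eval {N r M : ℕ} (hN : 0 < N) {B τ : ℝ} (hlam : 1 ≤ N * B)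
    (hτ : 4 / τ = 2 ^ M) (q : (Fin n → Fin (N + 2)) × Monomial n r) (x : Fin n → ℝ) :
    ∏ s ∈ Finset.range (n + r + M), (termGate (N * B) τ s q).eval (N * B) x =
      (∏ i, bump N B (q.1 i) (x i)) * ∏ m, (4 / τ * (Real.sigmoid (τ * (x (q.2.2 m) -
        center N (q.1 (q.2.2 m)))) - 1 / 2)) := by
  obtain ⟨j, ⟨k, hk⟩, ι⟩ := q
  rw [Finset.prod_range_add, Finset.prod_range_add, mul_assoc]
  congr 1
  · rw [Finset.prod_range]
    refine Finset.prod_congr rfl fun i _ => ?_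
    simp [termGate, bumpGate_eval hN]
  · -- The remaining factors: `k` factors of the monomial, then ones, then the amplification.
    obtain ⟨b, hb⟩ := Nat.exists_eq_add_of_lt hk
    have hsplit : ∀ F : ℕ → ℝ, ∏ s ∈ Finset.range r, F s =
        (∏ s : Fin k, F s) * ∏ s ∈ Finset.range (b + 1), F (k + s) := by
      intro F
      rw [hb, add_assoc, Finset.prod_range_add, Finset.prod_range]
    rw [hsplit]
    have h1 : ∏ s ∈ Finset.range (b + 1), (termGate (N * B) τ (n + (k + s))
        (j, (⟨⟨k, hk⟩, ι⟩ : Monomial n r))).eval (N * B) x = 1 := by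
      refine Finset.prod_eq_one fun s hs => ?_
      rw [Finset.mem_range] at hs
      have h2 : n + (k + s) < n + r := by omega
      simp only [termGate]
      rw [dif_neg (by omega), dif_neg (by omega), if_pos h2, Gate.const_eval n hlam]
    have h2 : ∏ s ∈ Finset.range M, (termGate (N * B) τ (n + r + s)
        (j, (⟨⟨k, hk⟩, ι⟩ : Monomial n r))).eval (N * B) x = (2 ^ M) ^ k := by
      rw [← pow_mul, mul_comm M k, pow_mul, ← Finset.card_range M, ← Finset.prod_const,
        Finset.card_range]
      refine Finset.prod_congr rfl fun s _ => ?_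
      simp only [termGate]
      rw [dif_neg (by omega), dif_neg (by omega), if_neg (by omega), Gate.const_eval n hlam]
    rw [h1, h2, Finset.prod_mul_distrib, hτ]
    simp only [Finset.prod_const, Finset.card_univ, Fintype.card_fin, mul_one]
    rw [mul_comm]
    congr 1
    refine Finset.prod_congr rfl fun m _ => ?_
    have h3 : n + (m : ℕ) - n < k := by rw [Nat.add_sub_cancel_left]; exact m.2
    simp only [termGate]
    rw [dif_neg (by omega), dif_pos h3, factorGate_eval (by linarith)]
    simp

/-- The local polynomials, with the linear factors replaced by rescaled sigmoids, approximate a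
smooth function to order `r`. -/
lemma abs_sum_monomial_sub_le {r : ℕ} (hr : 0 < r) {g : (Fin n → ℝ) → ℝ} (hg : ContDiff ℝ ∞ g)
    (hD : ∀ l : List (Fin n), l.length ≤ r → ∀ x ∈ Set.Icc (0 : Fin n → ℝ) 1, |listD l g x| ≤ 1)
    {t x : Fin n → ℝ} (ht : t ∈ Set.Icc (0 : Fin n → ℝ) 1) (hx : x ∈ Set.Icc (0 : Fin n → ℝ) 1)
    {τ : ℝ} (hτ0 : 0 < τ) (hτ1 : τ ≤ 1) {h : ℝ} (hh : ∀ i, |x i - t i| ≤ h) :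
    |∑ q : Monomial n r, ((((q.1 : ℕ).factorial : ℝ)⁻¹ * listD (List.ofFn q.2) g t) *
      ∏ m, (4 / τ * (Real.sigmoid (τ * (x (q.2 m) - t (q.2 m))) - 1 / 2))) - g x| ≤
    Fintype.card (Monomial n r) * (r * τ) + n ^ r * h ^ r := by
  have hT := abs_sub_taylor_le hr hg hD ht hx hh
  rw [Finset.sum_range (fun k => ∑ ι : Fin k → Fin n,
    ((k.factorial : ℝ)⁻¹ * listD (List.ofFn ι) g t) * ∏ m, (x (ι m) - t (ι m))),
    ← Fintype.sum_sigma' (fun (k : Fin r) (ι : Fin k → Fin n) =>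
      (((k : ℕ).factorial : ℝ)⁻¹ * listD (List.ofFn ι) g t) * ∏ m, (x (ι m) - t (ι m)))] at hT
  have hxt : ∀ i, |x i - t i| ≤ 1 := by
    intro i
    have h1 := hx.1 i
    have h2 := hx.2 i
    have h3 := ht.1 i
    have h4 := ht.2 i
    simp only [Pi.zero_apply, Pi.one_apply] at h1 h2 h3 h4
    rw [abs_le]
    constructor <;> linarith
  have hcoef : ∀ q : Monomial n r,
      |((q.1 : ℕ).factorial : ℝ)⁻¹ * listD (List.ofFn q.2) g t| ≤ 1 := by
    intro q
    have h1 := hD (List.ofFn q.2) (by simp) t ht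
    have h2 : (1 : ℝ) ≤ (q.1 : ℕ).factorial := by exact_mod_cast (q.1 : ℕ).factorial_pos
    rw [abs_mul, abs_inv, Nat.abs_cast]
    exact mul_le_one₀ (inv_le_one_of_one_le₀ h2) (abs_nonneg _) h1
  have hdiff : |∑ q : Monomial n r, ((((q.1 : ℕ).factorial : ℝ)⁻¹ * listD (List.ofFn q.2) g t) *
      ∏ m, (4 / τ * (Real.sigmoid (τ * (x (q.2 m) - t (q.2 m))) - 1 / 2))) -
      ∑ q : Monomial n r, (((q.1 : ℕ).factorial : ℝ)⁻¹ * listD (List.ofFn q.2) g t) *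
        ∏ m, (x (q.2 m) - t (q.2 m))| ≤ Fintype.card (Monomial n r) * (r * τ) := by
    rw [← Finset.sum_sub_distrib]
    refine (Finset.abs_sum_le_sum_abs _ _).trans ?_
    rw [← nsmul_eq_mul, ← Finset.card_univ, ← Finset.sum_const]
    refine Finset.sum_le_sum fun q _ => ?_
    rw [← mul_sub, abs_mul]
    refine (mul_le_of_le_one_left (abs_nonneg _) (hcoef q)).trans ?_
    refine (abs_prod_sub_prod_le Finset.univ _ _ (fun m => abs_rescaled_sigmoid_le hτ0 (hxt _))
      (fun m => hxt _) fun m => abs_rescaled_sigmoid_sub_le hτ0 hτ1 (hxt _)).trans ?_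
    rw [Finset.card_univ, Fintype.card_fin]
    exact mul_le_mul_of_nonneg_right (by exact_mod_cast q.1.2.le) hτ0.le
  rw [abs_sub_comm] at hT
  exact (abs_sub_le _ _ _).trans (add_le_add hdiff hT)

/-- The approximation theorem with explicit parameters: `N` cells per coordinate and `M` layers of
amplification. -/
theorem exists_transformer_approx {d L r N M : ℕ} (hdL : L * d = n) (hn : 0 < n) (hr : 0 < r)
    {f : (Fin n → ℝ) → ℝ} (hf : ContinuousOn f (Set.Icc 0 1)) (hmem : MemSobolevUnitBall r f)
    (hN : 0 < N) (hM : 2 ≤ M) {η : ℝ} (hη : 0 < η) :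
    ∃ (W : ℕ) (CKQ CV : ℝ), ∃ G ∈ TransformerClass d L 1
        (((N + 2) ^ n * Fintype.card (Monomial n r) + n + 1) * 2) W (n + r + M + 2) CKQ CV
        (N * ((N + 2) ^ n * N ^ r)),
      (∀ X : Matrix (Fin d) (Fin L) ℝ, (∀ i j, X i j ∈ Set.Icc (0 : ℝ) 1) →
        ∀ i j, |G X i j - f (vecCols hdL X)| ≤ η +
          (Fintype.card (Monomial n r) * (r * 4) / 2 ^ M +
            (n ^ r * 2 ^ r + n ^ r + 2 * n) / N ^ r)) ∧
      W ≤ (N + 2) ^ n * Fintype.card (Monomial n r) + 2 * n + 1 ∧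
      CKQ ≤ 8 * 2 ^ r + 2 * n ∧ CV ≤ 8 * 2 ^ r + (n + 2) := by
  obtain ⟨g, hg, hD, hgf⟩ := exists_smooth_approx hf hmem hη
  have hN' : (1 : ℝ) ≤ N := by exact_mod_cast hN
  have hN0 : (0 : ℝ) < N := by linarith
  have hNn : (1 : ℝ) ≤ (N + 2) ^ n := one_le_pow₀ (by linarith)
  have hNr : (1 : ℝ) ≤ (N : ℝ) ^ r := one_le_pow₀ hN'
  -- The steepness is chosen such that `(N + 2) ^ n * exp (-B) ≤ N ^ (-r)`.
  set B : ℝ := (N + 2) ^ n * N ^ r with hB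
  have hB1 : 1 ≤ B := one_le_mul_of_one_le_of_one_le hNn hNr
  have hlam : 1 ≤ N * B := one_le_mul_of_one_le_of_one_le hN' hB1
  have hexp : Real.exp (-B) ≤ B⁻¹ := by
    rw [Real.exp_neg]
    exact inv_anti₀ (by linarith) (by linarith [Real.add_one_le_exp B])
  set τ : ℝ := 4 / 2 ^ M with hτ
  have h2M : (4 : ℝ) ≤ 2 ^ M := by
    calc (4 : ℝ) = 2 ^ 2 := by norm_num
      _ ≤ 2 ^ M := pow_le_pow_right₀ (by norm_num) hM
  have hτ0 : 0 < τ := by positivity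
  have hτ1 : τ ≤ 1 := by rw [hτ, div_le_one (by linarith)]; exact h2M
  have hτM : 4 / τ = 2 ^ M := by rw [hτ]; field_simp
  let t : (Fin n → Fin (N + 2)) → Fin n → ℝ := fun j i => center N (j i)
  have ht : ∀ j, t j ∈ Set.Icc (0 : Fin n → ℝ) 1 := fun j =>
    ⟨fun i => (center_mem _ _).1, fun i => (center_mem _ _).2⟩
  let c : (Fin n → Fin (N + 2)) × Monomial n r → ℝ := fun q =>
    ((q.2.1 : ℕ).factorial : ℝ)⁻¹ * listD (List.ofFn q.2.2) g (t q.1)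
  have hr1 : (1 : ℝ) ≤ 2 ^ r := one_le_pow₀ (by norm_num)
  have hc : ∀ q, 8 * |c q| ≤ 8 * 2 ^ r := by
    intro q
    have h1 := hD (List.ofFn q.2.2) (by simp) _ (ht q.1)
    have h2 : (1 : ℝ) ≤ (q.2.1 : ℕ).factorial := by exact_mod_cast (q.2.1 : ℕ).factorial_pos
    have h3 : |c q| ≤ 1 := by
      simp only [c]
      rw [abs_mul, abs_inv, Nat.abs_cast]
      exact mul_le_one₀ (inv_le_one_of_one_le₀ h2) (abs_nonneg _) h1
    linarith
  obtain ⟨W, CKQ, CV, G, hG, hGeq, hW, hCKQ, hCV⟩ := exists_transformer_sum_prod hdL hn hlam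
    (B := 8 * 2 ^ r) (by linarith) (n + r + M) c (fun s q => termGate (N * B) τ s q) hc
    (fun s q => termGate_bounded hN hlam hτ0.le hτ1 s q)
  have hcard : Fintype.card ((Fin n → Fin (N + 2)) × Monomial n r) =
      (N + 2) ^ n * Fintype.card (Monomial n r) := by
    rw [Fintype.card_prod, Fintype.card_fun, Fintype.card_fin, Fintype.card_fin]
  rw [hcard] at hG hW
  refine ⟨W, CKQ, CV, G, hG, ?_, hW, hCKQ, hCV⟩
  intro X hX i j
  set x := vecCols hdL X with hx
  have hx01 : x ∈ Set.Icc (0 : Fin n → ℝ) 1 :=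
    ⟨fun k => (hX _ _).1, fun k => (hX _ _).2⟩
  have hsum : G X i j = ∑ j, (∏ i, bump N B (j i) (x i)) * ∑ q : Monomial n r,
      ((((q.1 : ℕ).factorial : ℝ)⁻¹ * listD (List.ofFn q.2) g (t j)) *
      ∏ m, (4 / τ * (Real.sigmoid (τ * (x (q.2 m) - t j (q.2 m))) - 1 / 2))) := by
    rw [hGeq, Fintype.sum_prod_type]
    refine Finset.sum_congr rfl fun j _ => ?_
    rw [Finset.mul_sum]
    refine Finset.sum_congr rfl fun q _ => ?_
    rw [prod_termGate_eval hN hlam hτM]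
    simp only [c, t]
    ring
  have hmain := abs_sum_prod_bump_mul_sub_le hN (B := B) (by linarith) (r := r) hx01
    (y := g x) (A := Fintype.card (Monomial n r) * (r * τ)) (Q := n ^ r)
    (hD [] (Nat.zero_le _) x hx01) (by positivity) (by positivity) _
    (fun j h hh => abs_sum_monomial_sub_le hr hg hD (ht j) hx01 hτ0 hτ1 hh)
  rw [← hsum] at hmain
  have e1 : ((N : ℝ) + 2) ^ n * Real.exp (-B) ≤ ((N : ℝ) ^ r)⁻¹ := by
    refine (mul_le_mul_of_nonneg_left hexp (by linarith)).trans_eq ?_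
    rw [hB]
    field_simp
  have e2 : Real.exp (-B) ≤ ((N : ℝ) ^ r)⁻¹ :=
    (le_mul_of_one_le_left (Real.exp_pos _).le hNn).trans e1
  have e3 : (n : ℝ) ^ r * (2 / N) ^ r = n ^ r * 2 ^ r * ((N : ℝ) ^ r)⁻¹ := by
    rw [div_pow]; ring
  have e4 : (Fintype.card (Monomial n r) : ℝ) * (r * τ) =
      Fintype.card (Monomial n r) * (r * 4) / 2 ^ M := by
    rw [hτ]; ring
  have e5 : (n : ℝ) ^ r * (((N : ℝ) + 2) ^ n * Real.exp (-B)) ≤ n ^ r * ((N : ℝ) ^ r)⁻¹ :=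
    mul_le_mul_of_nonneg_left e1 (by positivity)
  have e6 : 2 * (n : ℝ) * Real.exp (-B) ≤ 2 * n * ((N : ℝ) ^ r)⁻¹ :=
    mul_le_mul_of_nonneg_left e2 (by positivity)
  have h1 := hgf x hx01
  have h2 := abs_sub_le (G X i j) (g x) (f x)
  rw [div_eq_mul_inv _ ((N : ℝ) ^ r), add_mul, add_mul]
  linarith

/-! ### Choice of the parameters -/

/-- The number of cells per coordinate that is needed for accuracy `1 / δ`. -/
lemma exists_cell_count {r : ℕ} (hr : 0 < r) {A : ℝ} (hA : 1 ≤ A) :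
    ∃ c : ℝ, 0 < c ∧ ∀ δ : ℝ, 1 < δ → ∃ N : ℕ, 0 < N ∧ 4 * A * δ ≤ (N : ℝ) ^ r ∧
      (N : ℝ) + 2 ≤ c * δ ^ ((1 : ℝ) / r) := by
  refine ⟨6 * (4 * A) ^ ((1 : ℝ) / r), by positivity, fun δ hδ => ?_⟩
  have hr0 : (r : ℝ) ≠ 0 := by exact_mod_cast hr.ne'
  have hbase : 1 ≤ 4 * A * δ := by nlinarith
  have hroot : 1 ≤ (4 * A * δ) ^ ((1 : ℝ) / r) := Real.one_le_rpow hbase (by positivity)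
  refine ⟨⌈(4 * A * δ) ^ ((1 : ℝ) / r)⌉₊, Nat.ceil_pos.2 (by linarith), ?_, ?_⟩
  · have h := pow_le_pow_left₀ (by linarith) (Nat.le_ceil ((4 * A * δ) ^ ((1 : ℝ) / r))) r
    rwa [← Real.rpow_natCast, ← Real.rpow_mul (by linarith), one_div_mul_cancel hr0,
      Real.rpow_one] at h
  · have h := (Nat.ceil_lt_add_one (by linarith : 0 ≤ (4 * A * δ) ^ ((1 : ℝ) / r))).le
    rw [mul_assoc 6, ← Real.mul_rpow (by linarith) (by linarith)]
    linarith

/-- The number of layers of amplification that is needed for accuracy `1 / δ`. -/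
lemma exists_amplification_depth {A : ℝ} (hA : 1 ≤ A) :
    ∃ c : ℝ, 0 ≤ c ∧ ∀ δ : ℝ, 1 < δ → ∃ M : ℕ, 2 ≤ M ∧ 4 * A * δ ≤ 2 ^ M ∧
      (2 ≤ δ → (M : ℝ) ≤ c * Real.log δ) := by
  have ha : 0 ≤ Real.log (4 * A) := Real.log_nonneg (by linarith)
  refine ⟨4 * Real.log (4 * A) + 8, by positivity, fun δ hδ => ?_⟩
  have hlog2 : 1 / 2 < Real.log 2 := by linarith [Real.log_two_gt_d9]
  have hAδ : 1 ≤ 4 * A * δ := by nlinarith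
  refine ⟨⌈Real.log (4 * A * δ) / Real.log 2⌉₊ + 2, by omega, ?_, fun hδ2 => ?_⟩
  · have h := Nat.le_ceil (Real.log (4 * A * δ) / Real.log 2)
    rw [div_le_iff₀ (by linarith), ← Real.log_pow] at h
    refine ((Real.log_le_log_iff (by linarith) (by positivity)).1 h).trans ?_
    exact pow_le_pow_right₀ (by norm_num) (by omega)
  · have hl : 1 / 2 ≤ Real.log δ := hlog2.le.trans (Real.log_le_log (by norm_num) hδ2)
    have h1 := (Nat.ceil_lt_add_one
      (div_nonneg (Real.log_nonneg hAδ) (by linarith : 0 ≤ Real.log 2))).le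
    have h2 : Real.log (4 * A * δ) / Real.log 2 ≤ 2 * (Real.log (4 * A) + Real.log δ) := by
      rw [Real.log_mul (by linarith) (by linarith), div_le_iff₀ (by linarith)]
      have := mul_le_mul_of_nonneg_left hlog2.le
        (by linarith : 0 ≤ Real.log (4 * A) + Real.log δ)
      linarith
    have h3 := mul_le_mul_of_nonneg_left hl ha
    push_cast
    linarith

lemma pow_le_rpow_of_le {r m : ℕ} {N c δ : ℝ} (hN : 0 ≤ N) (hδ : 0 ≤ δ)
    (h : N ≤ c * δ ^ ((1 : ℝ) / r)) : N ^ m ≤ c ^ m * δ ^ ((m : ℝ) / r) := by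
  refine (pow_le_pow_left₀ hN h m).trans_eq ?_
  rw [mul_pow, ← Real.rpow_natCast (δ ^ ((1 : ℝ) / r)), ← Real.rpow_mul hδ]
  ring_nf

/-- A constant is at most a multiple of `x * l` if `x ≥ 1` and `l ≥ 1 / 2`. -/
lemma le_two_mul_mul {c x l : ℝ} (hc : 0 ≤ c) (hx : 1 ≤ x) (hl : 1 / 2 ≤ l) :
    c ≤ 2 * c * (x * l) := by
  have h : 1 / 2 ≤ x * l := hl.trans (le_mul_of_one_le_left (by linarith) hx)
  have := mul_le_mul_of_nonneg_left h (by positivity : 0 ≤ 2 * c)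
  linarith

end Approximation

end

theorem mainTheorem3 (n r : ℕ) (hn : 0 < n) (hr : 0 < r) :
    ∃ C : ℝ, 0 < C ∧ ∃ p q : Polynomial ℝ,
      ∀ (d L : ℕ) (hdL : L * d = n) (f : (Fin n → ℝ) → ℝ),
        ContinuousOn f (Set.Icc 0 1) → MemSobolevUnitBall r f →
        ∀ ε δ : ℝ, 0 < ε → ε < 1 → δ = ε⁻¹ →
          ∃ (H W K : ℕ) (CKQ CV lam : ℝ), ∃ g ∈ TransformerClass d L 1 H W K CKQ CV lam,
            (∀ X : Matrix (Fin d) (Fin L) ℝ, (∀ i j, X i j ∈ Set.Icc (0 : ℝ) 1) →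
              ∀ i j, |g X i j - f (vecCols hdL X)| ≤ ε) ∧
            (ε ≤ 1 / 2 →
              (H : ℝ) ≤ C * (δ ^ ((n : ℝ) / r) * Real.log δ) ∧
              (W : ℝ) ≤ C * (δ ^ ((n : ℝ) / r) * Real.log δ) ∧
              (K : ℝ) ≤ C * Real.log δ ∧
              CV ≤ C * (δ ^ (((n : ℝ) + 2) / (2 * r)) * √(Real.log δ)) ∧
              CKQ ≤ C * Real.log δ ∧
              lam ≤ C * (δ ^ (p.eval (Real.log δ)) *
                Real.log δ ^ (q.eval (Real.log δ)))) := by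
  have hn1 : (1 : ℝ) ≤ n := by exact_mod_cast hn
  have hA₀ : (1 : ℝ) ≤ Fintype.card (Monomial n r) * (r * 4) + 1 := by
    have : (0 : ℝ) ≤ Fintype.card (Monomial n r) * (r * 4) := by positivity
    linarith
  have hA₁ : (1 : ℝ) ≤ n ^ r * 2 ^ r + n ^ r + 2 * n := by
    have : (0 : ℝ) ≤ n ^ r * 2 ^ r + n ^ r := by positivity
    linarith
  obtain ⟨c₁, hc₁, hcell⟩ := exists_cell_count hr hA₁
  obtain ⟨c₂, hc₂, hdepth⟩ := exists_amplification_depth hA₀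
  obtain ⟨R, hR⟩ : ∃ R : ℝ, R = Fintype.card (Monomial n r) := ⟨_, rfl⟩
  have hR0 : 0 ≤ R := hR ▸ Nat.cast_nonneg _
  set C₁ : ℝ := 2 * (2 * (c₁ ^ n * R + 2 * n + 1)) with hC₁
  set C₂ : ℝ := 2 * (n + r + 2) + c₂ with hC₂
  set C₃ : ℝ := 2 * (8 * 2 ^ r + (2 * n + 2)) with hC₃
  set C₄ : ℝ := c₁ ^ (n + r + 1) with hC₄
  have hC₁0 : 0 ≤ C₁ := by positivity
  have hC₂0 : 0 ≤ C₂ := by positivity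
  have hC₃0 : 0 < C₃ := by positivity
  have hC₄0 : 0 ≤ C₄ := by positivity
  refine ⟨C₁ + C₂ + C₃ + C₄, by positivity, Polynomial.C (((n : ℝ) + r + 1) / r), 0, ?_⟩
  intro d L hdL f hf hmem ε δ hε0 hε1 hδ
  have hδ1 : 1 < δ := by rw [hδ]; exact (one_lt_inv₀ hε0).2 hε1
  have hεδ : ε * δ = 1 := by rw [hδ]; exact mul_inv_cancel₀ hε0.ne'
  obtain ⟨N, hNpos, hNr, hNle⟩ := hcell δ hδ1
  obtain ⟨M, hM2, hMlow, hMle⟩ := hdepth δ hδ1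
  obtain ⟨W, CKQ, CV, G, hG, hGapprox, hW, hCKQ, hCV⟩ := exists_transformer_approx (N := N) (M := M)
    hdL hn hr hf hmem hNpos hM2 (half_pos hε0)
  -- The smoothing costs `ε / 2`, the sigmoid factors and the Taylor expansion `ε / 4` each.
  have herr : ∀ {a b : ℝ}, 0 < b → 4 * a * δ ≤ b → a / b ≤ ε / 4 := by
    intro a b hb h
    rw [div_le_iff₀ hb]
    have h3 := mul_le_mul_of_nonneg_left h (by linarith : 0 ≤ ε / 4)
    have h4 : ε / 4 * (4 * a * δ) = a := by linear_combination a * hεδ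
    linarith
  refine ⟨_, W, _, CKQ, CV, _, G, hG, fun X hX i j => (hGapprox X hX i j).trans ?_, fun hε2 => ?_⟩
  · have h1 := herr (by positivity) hNr
    have h2 := herr (a := Fintype.card (Monomial n r) * (r * 4)) (by positivity)
      ((by linarith : _ ≤ _).trans hMlow)
    linarith
  · have hδ2 : 2 ≤ δ := by
      rw [hδ]; exact (le_inv_comm₀ (by norm_num) hε0).2 (by linarith)
    have hMle := hMle hδ2
    have hl2 : 1 / 2 ≤ Real.log δ :=
      (by linarith [Real.log_two_gt_d9] : 1 / 2 ≤ Real.log 2).trans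
        (Real.log_le_log (by norm_num) hδ2)
    generalize Real.log δ = l at hl2 hMle ⊢
    have hN2 : (0 : ℝ) ≤ (N : ℝ) + 2 := by positivity
    have hD1 : 1 ≤ δ ^ ((n : ℝ) / r) := Real.one_le_rpow hδ1.le (by positivity)
    have hpow : ((N : ℝ) + 2) ^ n * R ≤ c₁ ^ n * δ ^ ((n : ℝ) / r) * R :=
      mul_le_mul_of_nonneg_right (pow_le_rpow_of_le hN2 (by linarith) hNle) hR0
    have hwidth : 2 * (((N : ℝ) + 2) ^ n * R + 2 * n + 1) ≤
        (C₁ + C₂ + C₃ + C₄) * (δ ^ ((n : ℝ) / r) * l) := by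
      have h1 := mul_le_mul_of_nonneg_left hD1 (by linarith : 0 ≤ 2 * (n : ℝ) + 1)
      have h2 : 2 * (((N : ℝ) + 2) ^ n * R + 2 * n + 1) ≤ C₁ / 2 * δ ^ ((n : ℝ) / r) := by
        rw [hC₁]
        linarith
      refine h2.trans ((le_two_mul_mul (by positivity) le_rfl hl2).trans ?_)
      rw [one_mul]
      refine le_of_eq_of_le (by ring : _ = C₁ * (δ ^ ((n : ℝ) / r) * l)) ?_
      exact mul_le_mul_of_nonneg_right (by linarith) (by positivity)
    have hpos : 0 ≤ ((N : ℝ) + 2) ^ n * R := by positivity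
    have hconst : ∀ {x : ℝ}, 1 ≤ x → ∀ {y : ℝ}, 1 / 2 ≤ y → C₃ / 2 ≤
        (C₁ + C₂ + C₃ + C₄) * (x * y) := by
      intro x hx y hy
      refine (le_two_mul_mul (by positivity) hx hy).trans ?_
      exact mul_le_mul_of_nonneg_right (by linarith) (mul_nonneg (by linarith) (by linarith))
    refine ⟨?_, ?_, ?_, ?_, ?_, ?_⟩
    · push_cast
      rw [← hR]
      linarith
    · have h1 : (W : ℝ) ≤ ((N : ℝ) + 2) ^ n * R + 2 * n + 1 := by rw [hR]; exact_mod_cast hW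
      linarith
    · push_cast
      have h5 : (n : ℝ) + r + M + 2 ≤ C₂ * l := by
        have h6 := mul_le_mul_of_nonneg_left hl2 (by positivity : 0 ≤ 2 * ((n : ℝ) + r + 2))
        rw [hC₂]
        linarith
      exact h5.trans (mul_le_mul_of_nonneg_right (by linarith) (by linarith))
    · have h1 : 1 ≤ δ ^ (((n : ℝ) + 2) / (2 * r)) := Real.one_le_rpow hδ1.le (by positivity)
      have h2 : 1 / 2 ≤ √l := Real.le_sqrt_of_sq_le (by linarith)
      refine le_trans ?_ (hconst h1 h2)
      linarith
    · have h := hconst le_rfl hl2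
      rw [one_mul] at h
      refine le_trans ?_ h
      linarith
    · rw [Polynomial.eval_C, Polynomial.eval_zero, Real.rpow_zero, mul_one]
      have h1 : (N : ℝ) * ((N + 2) ^ n * N ^ r) ≤ ((N : ℝ) + 2) ^ (n + r + 1) := by
        have h2 : (N : ℝ) ^ r ≤ (N + 2) ^ r :=
          pow_le_pow_left₀ (Nat.cast_nonneg N) (by linarith) r
        calc (N : ℝ) * ((N + 2) ^ n * N ^ r) ≤ (N + 2) * ((N + 2) ^ n * (N + 2) ^ r) := by
              gcongr
              linarith
          _ = ((N : ℝ) + 2) ^ (n + r + 1) := by ring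
      have h2 : ((N : ℝ) + 2) ^ (n + r + 1) ≤ C₄ * δ ^ (((n : ℝ) + r + 1) / r) := by
        have := pow_le_rpow_of_le (m := n + r + 1) hN2 (by linarith) hNle
        push_cast at this
        exact this
      exact (h1.trans h2).trans (mul_le_mul_of_nonneg_right (by linarith) (by positivity))
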